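/- **Setting (Friedrichs model).** Let $\phi,\psi\in L^2(\mathbb R)$, and write $\langle f,g\rangle=\int f\overline g$. Let $\mathcal D$ be the set of $u\in L^2(\mathbb R)$ for which there is a (necessarily unique) constant $c_u\in\mathbb C$ with $xu(x)-c_u\in L^2(\mathbb R)$. For $u\in\mathcal D$ put $$(\widetilde A^*u)(x)=xu(x)-c_u+\langle u,\phi\rangle\psi(x),\qquad \Gamma_1u=\lim_{R\to\infty}\int_{-R}^{R}u(x)\,dx,\qquad \Gamma_2u=c_u .$$ For $B\in\mathbb C$ let $A_B$ be the restriction of $\widetilde A^*$ to $\ker(\Gamma_1-B\Gamma_2)$, with resolvent set $\rho(A_B)$. For $\lambda\in\rho(A_B)$ let $S_{\lambda,B}$ be the solution operator: $u=S_{\lambda,B}a$ means $(\widetilde A^*-\lambda)u=0$ and $(\Gamma_1-B\Gamma_2)u=a$. The detectable subspace $\overline{\mathcal S}=\overline{\mathcal S}(\phi,\psi)$ is the closed linear span in $L^2(\mathbb R)$ of the ranges of all $S_{\lambda,B}$ with $B\in\mathbb C$, $\lambda\in\rho(A_B)$. For $\mu\in\mathbb C\setminus\mathbb R$ put $$\widehat{\overline\phi}(\mu)=\int_{\mathbb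 R}\frac{\overline{\phi(t)}}{t-\mu}\,dt,\qquad D(\mu)=D_{\phi,\psi}(\mu)=1+\int_{\mathbb R}\frac{\psi(x)\overline{\phi(x)}}{x-\mu}\,dx .$$ Let $\mathbb C_\pm=\{\mu:\pm\operatorname{Im}\mu>0\}$, let $\Omega$ be the set of $\mu\in\mathbb C\setminus\mathbb R$ at which both $\frac{1}{x-\mu}$ and $\frac{\psi(x)}{x-\mu}$ lie in $\overline{\mathcal S}$, and let $\Omega_\pm=\Omega\cap\mathbb C_\pm$. Let $H_2^\pm\subset L^2(\mathbb R)$ be the Hardy space of $L^2$ boundary values of the functions $F$ that are holomorphic in $\mathbb C_\pm$ and satisfy $\sup_{y>0}\int_{\mathbb R}|F(x\pm iy)|^2dx<\infty$. **Lemma.** For each choice of the sign $\pm$ the following holds. 1. If $\mathbb C_\pm\setminus\Omega_\pm$ has Lebesgue measure zero, then $H_2^\mp\subseteq\overline{\mathcal S}$. 2. If $\mathbb C_\pm\setminus\Omega_\pm$ has positive measure, then $\widehat{\overline\phi}(\mu)/D(\mu)$ is uniquely recoverable from $\psi$ and $\overline{\mathcal S}$ for $\mu\in\mathbb C_\pm$,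 in the following sense. (a) For every $\mu\in\mathbb C_\pm\setminus\Omega_\pm$ with $D(\mu)\ne0$, the number $\eta=\widehat{\overline\phi}(\mu)/D(\mu)$ is the only $\eta\in\mathbb C$ for which $\frac1{x-\mu}-\eta\,\frac{\psi(x)}{x-\mu}$ lies in $\overline{\mathcal S}$. (b) If $\phi'\in L^2(\mathbb R)$ satisfies $\overline{\mathcal S}(\phi',\psi)=\overline{\mathcal S}(\phi,\psi)$, then $\widehat{\overline{\phi'}}(\mu)/D_{\phi',\psi}(\mu)=\widehat{\overline\phi}(\mu)/D_{\phi,\psi}(\mu)$ for all $\mu\in\mathbb C_\pm$ with $D_{\phi,\psi}(\mu)\ne0$ and $D_{\phi',\psi}(\mu)\neq0$. -/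

import Mathlib

open MeasureTheory Filter Topology

noncomputable section

namespace Friedrichs

/-- The Hilbert space `L²(ℝ)` of complex valued functions. The pairing `⟨f, g⟩ = ∫ f ḡ`, linear in
its first argument, is `inner ℂ g f` here. -/
abbrev L2 : Type := Lp ℂ 2 (volume : Measure ℝ)

/-! ### The maximal operator and its traces -/

/-- `c` is the constant `c_f` of `f`: the function `x f(x) - c` is square integrable. -/
def IsTraceConst (f : L2) (c : ℂ) : Prop :=
  MemLp (fun x : ℝ => (x : ℂ) * f x - c) 2 volume

theorem IsTraceConst.unique {f : L2} {c c' : ℂ} (h : IsTraceConst f c) (h' : IsTraceConst f c') :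
    c = c' := by
  have h1 : MemLp (fun _ : ℝ => c - c') 2 volume := by
    have h2 := MemLp.sub h' h
    refine h2.ae_eq (Eventually.of_forall fun x => ?_)
    simp only [Pi.sub_apply]
    ring
  rw [memLp_const_iff (by norm_num) (by norm_num)] at h1
  rcases h1 with h1 | h1
  · exact sub_eq_zero.mp h1
  · simp at h1

theorem IsTraceConst.add {f g : L2} {c d : ℂ} (hf : IsTraceConst f c) (hg : IsTraceConst g d) :
    IsTraceConst (f + g) (c + d) := by
  refine (MemLp.add hf hg).ae_eq ?_
  filter_upwards [Lp.coeFn_add f g] with x hx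
  simp only [Pi.add_apply] at hx ⊢
  rw [hx]
  ring

theorem IsTraceConst.smul {f : L2} {c : ℂ} (a : ℂ) (hf : IsTraceConst f c) :
    IsTraceConst (a • f) (a * c) := by
  refine (MemLp.const_smul hf a).ae_eq ?_
  filter_upwards [Lp.coeFn_smul a f] with x hx
  simp only [Pi.smul_apply, smul_eq_mul] at hx ⊢
  rw [hx]
  ring

theorem isTraceConst_zero : IsTraceConst 0 0 := by
  have h : MemLp (fun _ : ℝ => (0 : ℂ)) 2 volume := MemLp.zero'
  refine h.ae_eq ?_
  filter_upwards [Lp.coeFn_zero ℂ 2 (volume : Measure ℝ)] with x _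
  simp

/-- `Dom(A*) = Dom(Ã*)`: all `f ∈ L²(ℝ)` such that `x f(x) - c` lies in `L²(ℝ)` for some `c`. -/
def maxDomain : Submodule ℂ L2 where
  carrier := {f | ∃ c : ℂ, IsTraceConst f c}
  add_mem' := by
    rintro f g ⟨c, hc⟩ ⟨d, hd⟩
    exact ⟨c + d, hc.add hd⟩
  zero_mem' := ⟨0, isTraceConst_zero⟩
  smul_mem' := by
    rintro a f ⟨c, hc⟩
    exact ⟨a * c, hc.smul a⟩

/-- The trace `Γ₂ u = c_u`. -/
def gammaTwo (u : maxDomain) : ℂ := Classical.choose u.2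

theorem gammaTwo_spec (u : maxDomain) : IsTraceConst (u : L2) (gammaTwo u) :=
  Classical.choose_spec u.2

/-- The trace `Γ₁ u = lim_{R → ∞} ∫_{-R}^{R} u(x) dx`. -/
def gammaOne (u : maxDomain) : ℂ :=
  limUnder atTop (fun R : ℝ => ∫ x in (-R)..R, (u : L2) x)

/-- The operator `(Ã* u)(x) = x u(x) - c_u + ⟨u, φ⟩ ψ(x)` on `maxDomain`. -/
def maxOp (φ ψ : L2) (u : maxDomain) : L2 :=
  (gammaTwo_spec u).toLp (fun x : ℝ => (x : ℂ) * (u : L2) x - gammaTwo u)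
    + (inner ℂ φ (u : L2) : ℂ) • ψ

/-- `Dom(A_B) = ker(Γ₁ - B Γ₂)`; the operator `A_B` is the restriction of `maxOp φ ψ` to it. -/
def InDomain (B : ℂ) (u : maxDomain) : Prop := gammaOne u - B * gammaTwo u = 0

/-- The resolvent set of `A_B`: the numbers `z` for which `A_B - z : Dom(A_B) → L²(ℝ)` is bijective
with a bounded inverse. -/
def resolventSetOp (φ ψ : L2) (B : ℂ) : Set ℂ :=
  {z | ∃ R : L2 →L[ℂ] L2,
    (∀ g : L2, ∃ u : maxDomain, (u : L2) = R g ∧ InDomain B u ∧ maxOp φ ψ u - z • (u : L2) = g) ∧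
    (∀ u : maxDomain, InDomain B u → R (maxOp φ ψ u - z • (u : L2)) = u)}

/-! ### The detectable subspace -/

/-- `Ran(S_{z,B})`, where the solution operator `S_{z,B}` sends `a` to the `u` with
`(Ã* - z) u = 0` and `(Γ₁ - B Γ₂) u = a`. -/
def solutionRange (φ ψ : L2) (B z : ℂ) : Set L2 :=
  {w | ∃ (a : ℂ) (u : maxDomain),
    maxOp φ ψ u - z • (u : L2) = 0 ∧ gammaOne u - B * gammaTwo u = a ∧ w = u}

/-- `𝒯_B`, the linear span of the ranges `Ran(S_{z,B})` over all `z ∈ ρ(A_B)`. -/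
def spaceT (φ ψ : L2) (B : ℂ) : Submodule ℂ L2 :=
  Submodule.span ℂ (⋃ z ∈ resolventSetOp φ ψ B, solutionRange φ ψ B z)

/-- The detectable subspace `𝒮̄`: the closed linear span of the ranges of all solution operators
`S_{z,B}`, with `B ∈ ℂ` and `z ∈ ρ(A_B)`. Its orthogonal complement is the intersection over `B`
and `z` of the kernels of the operators `S_{z,B}^*`. -/
def detectable (φ ψ : L2) : Submodule ℂ L2 := (⨆ B : ℂ, spaceT φ ψ B).topologicalClosure

/-- If the closure of `𝒯_B` is the same space for all `B` with `ρ(A_B) ≠ ∅`, then this common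
space is the detectable subspace. -/
theorem detectable_eq_of_independent (φ ψ : L2) (S : Submodule ℂ L2)
    (hne : ∃ B : ℂ, (resolventSetOp φ ψ B).Nonempty)
    (hS : ∀ B : ℂ, (resolventSetOp φ ψ B).Nonempty → (spaceT φ ψ B).topologicalClosure = S) :
    detectable φ ψ = S := by
  obtain ⟨B₀, hB₀⟩ := hne
  apply le_antisymm
  · refine Submodule.topologicalClosure_minimal _ (iSup_le fun B => ?_) ?_
    · by_cases hB : (resolventSetOp φ ψ B).Nonempty
      · rw [← hS B hB]
        exact Submodule.le_topologicalClosure _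
      · rw [Set.not_nonempty_iff_eq_empty] at hB
        simp [spaceT, hB]
    · rw [← hS B₀ hB₀]
      exact Submodule.isClosed_topologicalClosure _
  · rw [← hS B₀ hB₀]
    exact Submodule.topologicalClosure_mono (le_iSup (fun B => spaceT φ ψ B) B₀)

/-! ### Half-planes, Hardy spaces, Cauchy transforms, the non-uniqueness set -/

/-- The open half-plane `ℂ₊` for `s = 1` and `ℂ₋` for `s = -1`. -/
def halfPlane (s : ℤˣ) : Set ℂ := {μ | 0 < ((s : ℤ) : ℝ) * μ.im}

/-- The Hardy space `H₂^±(ℝ)`: the boundary values `f`, in the sense of `L²` limits, of the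
functions `F` that are holomorphic in the half-plane `ℂ_±` and bounded in `L²` on the horizontal
lines in it. -/
def hardySpace (s : ℤˣ) : Set L2 :=
  {f | ∃ F : ℂ → ℂ, DifferentiableOn ℂ F (halfPlane s) ∧
    (∃ C : NNReal, ∀ y : ℝ, 0 < y →
      eLpNorm (fun x : ℝ => F (x + ((s : ℤ) : ℂ) * y * Complex.I)) 2 volume ≤ C) ∧
    Tendsto (fun y : ℝ =>
        eLpNorm (fun x : ℝ => F (x + ((s : ℤ) : ℂ) * y * Complex.I) - f x) 2 volume)
      (𝓝[>] 0) (𝓝 0)}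

/-- The function `f` is square integrable, and its class lies in the subspace `S`. -/
def FunMem (f : ℝ → ℂ) (S : Submodule ℂ L2) : Prop :=
  ∃ hf : MemLp f 2 volume, hf.toLp f ∈ S

/-- The Cauchy transform of the conjugate of `φ`, that is `⟨1/(t - μ), φ⟩`. -/
def conjCauchy (φ : L2) (μ : ℂ) : ℂ :=
  ∫ t : ℝ, (1 / ((t : ℂ) - μ)) * (starRingEnd ℂ) (φ t)

/-- `D(μ) = 1 + ∫ ψ(x) φ̄(x) / (x - μ) dx`. -/
def perturbD (φ ψ : L2) (μ : ℂ) : ℂ :=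
  1 + ∫ x : ℝ, (1 / ((x : ℂ) - μ)) * ψ x * (starRingEnd ℂ) (φ x)

/-- The non-uniqueness set `Ω`. -/
def nonUniq (φ ψ : L2) : Set ℂ :=
  {μ | μ.im ≠ 0 ∧ FunMem (fun x : ℝ => 1 / ((x : ℂ) - μ)) (detectable φ ψ) ∧
    FunMem (fun x : ℝ => ψ x / ((x : ℂ) - μ)) (detectable φ ψ)}

end Friedrichs

end

noncomputable section

namespace Friedrichs

/-! ### The Cauchy kernel -/

/-! If `(Ã* - μ)u = 0`, then `u = (c_u - ⟨u, φ⟩ψ)/(x - μ)`. Pairing with `φ` gives a linear equation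
for `⟨u, φ⟩` with coefficient `D(μ)`, so for `D(μ) ≠ 0` the solutions are the multiples of `1/(x -
μ) - η ψ/(x - μ)`, with `η` the ratio to be recovered. Some `B` has `μ ∈ ρ(A_B)`, so this vector is
detectable (`defectVec_mem_detectable`).

Part 2: a second admissible `η` would put `ψ/(x - μ)`, hence also `1/(x - μ)`, into the detectable
space, that is `μ ∈ Ω`. Two functions `φ`, `φ'` with the same space thus have equal ratios off `Ω`
wherever both denominators are nonzero; after clearing denominators the identity theorem extends
this from a set of positive measure to the half-plane.

Part 1: let `v` be orthogonal to the detectable space. The Cauchy transform of `v̄` vanishes on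
`Ω_±`, hence on all of `ℂ_±`. By Cauchy's formula (`cauchy_formula_halfPlane`) and Fubini, `v` is
orthogonal to the restriction to each horizontal line of a Hardy function of `ℂ_∓`, and so to the
`L²` limit of these restrictions. Closedness of the space finishes the argument. -/

theorem ofReal_sub_ne_zero {μ : ℂ} (hμ : μ.im ≠ 0) (x : ℝ) : (x : ℂ) - μ ≠ 0 := by
  intro h
  apply hμ
  have := congrArg Complex.im h
  simpa using this

theorem abs_im_le_norm_ofReal_sub (μ : ℂ) (x : ℝ) : |μ.im| ≤ ‖(x : ℂ) - μ‖ := by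
  simpa using Complex.abs_im_le_norm ((x : ℂ) - μ)

theorem norm_cauchyKernel_le {μ : ℂ} (hμ : μ.im ≠ 0) (x : ℝ) :
    ‖1 / ((x : ℂ) - μ)‖ ≤ 1 / |μ.im| := by
  rw [norm_div, norm_one]
  exact one_div_le_one_div_of_le (abs_pos.mpr hμ) (abs_im_le_norm_ofReal_sub μ x)

theorem continuous_cauchyKernel {μ : ℂ} (hμ : μ.im ≠ 0) :
    Continuous fun x : ℝ => 1 / ((x : ℂ) - μ) :=
  continuous_const.div (by fun_prop) (ofReal_sub_ne_zero hμ)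

theorem normSq_ofReal_sub (μ : ℂ) (x : ℝ) :
    ‖(x : ℂ) - μ‖ ^ 2 = (x - μ.re) ^ 2 + μ.im ^ 2 := by
  rw [← Complex.normSq_eq_norm_sq, Complex.normSq_apply]
  simp
  ring

theorem poissonKernel_eq {μ : ℂ} (hμ : μ.im ≠ 0) (x : ℝ) :
    1 / ((x - μ.re) ^ 2 + μ.im ^ 2) =
      (μ.im ^ 2)⁻¹ * (1 + ((x - μ.re) / μ.im) ^ 2)⁻¹ := by
  have : 1 + ((x - μ.re) / μ.im) ^ 2 ≠ 0 := by positivity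
  field_simp
  ring

theorem integrable_poissonKernel {μ : ℂ} (hμ : μ.im ≠ 0) :
    Integrable fun x : ℝ => 1 / ((x - μ.re) ^ 2 + μ.im ^ 2) := by
  simp_rw [poissonKernel_eq hμ]
  exact ((integrable_inv_one_add_sq.comp_div hμ).comp_sub_right μ.re).const_mul _

theorem integral_poissonKernel {μ : ℂ} (hμ : μ.im ≠ 0) :
    ∫ x : ℝ, 1 / ((x - μ.re) ^ 2 + μ.im ^ 2) = Real.pi / |μ.im| := by
  simp_rw [poissonKernel_eq hμ]
  rw [integral_const_mul, integral_sub_right_eq_self (fun x => (1 + (x / μ.im) ^ 2)⁻¹) μ.re,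
    Measure.integral_comp_div (fun x => (1 + x ^ 2)⁻¹), integral_univ_inv_one_add_sq, smul_eq_mul,
    ← sq_abs]
  have := abs_pos.mpr hμ
  field_simp

theorem memLp_cauchyKernel {μ : ℂ} (hμ : μ.im ≠ 0) :
    MemLp (fun x : ℝ => 1 / ((x : ℂ) - μ)) 2 volume := by
  rw [memLp_two_iff_integrable_sq_norm (continuous_cauchyKernel hμ).aestronglyMeasurable]
  simp_rw [norm_div, norm_one, div_pow, one_pow, normSq_ofReal_sub]
  exact integrable_poissonKernel hμ

theorem integrable_mul_of_memLp_two {f g : ℝ → ℂ} (hf : MemLp f 2 volume)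
    (hg : MemLp g 2 volume) : Integrable fun x => f x * g x :=
  MemLp.integrable_mul hf hg

theorem memLp_star {f : ℝ → ℂ} (hf : MemLp f 2 volume) :
    MemLp (fun x => (starRingEnd ℂ) (f x)) 2 volume :=
  hf.star

theorem memLp_div_ofReal_sub {f : ℝ → ℂ} (hf : MemLp f 2 volume) {μ : ℂ} (hμ : μ.im ≠ 0) :
    MemLp (fun x : ℝ => f x / ((x : ℂ) - μ)) 2 volume := by
  refine MemLp.of_le_mul (c := 1 / |μ.im|) hf ?_ (Eventually.of_forall fun x => ?_)
  · simp_rw [div_eq_mul_one_div (f _)]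
    exact hf.1.mul (continuous_cauchyKernel hμ).aestronglyMeasurable
  · rw [div_eq_mul_one_div, norm_mul, mul_comm]
    exact mul_le_mul_of_nonneg_right (norm_cauchyKernel_le hμ x) (norm_nonneg _)

theorem inner_toLp_eq (φ : L2) {f : ℝ → ℂ} (hf : MemLp f 2 volume) :
    (inner ℂ φ (hf.toLp f) : ℂ) = ∫ x, f x * (starRingEnd ℂ) (φ x) := by
  rw [L2.inner_def]
  refine integral_congr_ae ?_
  filter_upwards [hf.coeFn_toLp] with x hx
  rw [hx]
  rfl

/-- The Cauchy kernel `1 / (x - μ)` as an element of `L²(ℝ)`. -/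
def cauchyVec {μ : ℂ} (hμ : μ.im ≠ 0) : L2 := (memLp_cauchyKernel hμ).toLp _

/-- Division by `x - μ` as a bounded operator on `L²(ℝ)`. -/
def divOp {μ : ℂ} (hμ : μ.im ≠ 0) : L2 →L[ℂ] L2 :=
  LinearMap.mkContinuous
    { toFun := fun f => (memLp_div_ofReal_sub (Lp.memLp f) hμ).toLp _
      map_add' := fun f g => by
        rw [← MemLp.toLp_add]
        refine MemLp.toLp_congr _ _ ?_
        filter_upwards [Lp.coeFn_add f g] with x hx
        simp only [Pi.add_apply] at hx ⊢
        rw [hx, add_div]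
      map_smul' := fun a f => by
        rw [RingHom.id_apply, ← MemLp.toLp_const_smul]
        refine MemLp.toLp_congr _ _ ?_
        filter_upwards [Lp.coeFn_smul a f] with x hx
        simp only [Pi.smul_apply, smul_eq_mul] at hx ⊢
        rw [hx, mul_div_assoc] } (1 / |μ.im|) fun f => by
    refine Lp.norm_le_mul_norm_of_ae_le_mul ?_
    filter_upwards [(memLp_div_ofReal_sub (Lp.memLp f) hμ).coeFn_toLp] with x hx
    simp only [LinearMap.coe_mk, AddHom.coe_mk]
    rw [hx, div_eq_mul_one_div, norm_mul, mul_comm]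
    exact mul_le_mul_of_nonneg_right (norm_cauchyKernel_le hμ x) (norm_nonneg _)

theorem coeFn_cauchyVec {μ : ℂ} (hμ : μ.im ≠ 0) :
    (cauchyVec hμ : ℝ → ℂ) =ᵐ[volume] fun x => 1 / ((x : ℂ) - μ) :=
  MemLp.coeFn_toLp _

theorem coeFn_divOp {μ : ℂ} (hμ : μ.im ≠ 0) (f : L2) :
    (divOp hμ f : ℝ → ℂ) =ᵐ[volume] fun x => f x / ((x : ℂ) - μ) :=
  MemLp.coeFn_toLp (memLp_div_ofReal_sub (Lp.memLp f) hμ)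

theorem inner_cauchyVec (φ : L2) {μ : ℂ} (hμ : μ.im ≠ 0) :
    (inner ℂ φ (cauchyVec hμ) : ℂ) = conjCauchy φ μ :=
  inner_toLp_eq φ _

theorem inner_divOp (φ ψ : L2) {μ : ℂ} (hμ : μ.im ≠ 0) :
    (inner ℂ φ (divOp hμ ψ) : ℂ) = perturbD φ ψ μ - 1 := by
  rw [perturbD, add_sub_cancel_left]
  refine (inner_toLp_eq φ (memLp_div_ofReal_sub (Lp.memLp ψ) hμ)).trans ?_
  congr 1 with x
  ring

theorem funMem_iff {f : ℝ → ℂ} {S : Submodule ℂ L2} {v : L2} (hv : (v : ℝ → ℂ) =ᵐ[volume] f) :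
    FunMem f S ↔ v ∈ S := by
  have hf : MemLp f 2 volume := (Lp.memLp v).ae_eq hv
  have : hf.toLp f = v := by
    rw [← Lp.toLp_coeFn v (Lp.memLp v)]
    exact MemLp.toLp_congr _ _ hv.symm
  exact ⟨fun ⟨_, h⟩ => this ▸ h, fun h => ⟨hf, this.symm ▸ h⟩⟩

theorem funMem_cauchyKernel_iff {μ : ℂ} (hμ : μ.im ≠ 0) (S : Submodule ℂ L2) :
    FunMem (fun x : ℝ => 1 / ((x : ℂ) - μ)) S ↔ cauchyVec hμ ∈ S :=
  funMem_iff (coeFn_cauchyVec hμ)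

theorem funMem_div_iff (ψ : L2) {μ : ℂ} (hμ : μ.im ≠ 0) (S : Submodule ℂ L2) :
    FunMem (fun x : ℝ => ψ x / ((x : ℂ) - μ)) S ↔ divOp hμ ψ ∈ S :=
  funMem_iff (coeFn_divOp hμ ψ)

theorem funMem_sub_iff (ψ : L2) {μ : ℂ} (hμ : μ.im ≠ 0) (η : ℂ) (S : Submodule ℂ L2) :
    FunMem (fun x : ℝ => 1 / ((x : ℂ) - μ) - η * (ψ x / ((x : ℂ) - μ))) S ↔
      cauchyVec hμ - η • divOp hμ ψ ∈ S := by
  refine funMem_iff ?_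
  filter_upwards [Lp.coeFn_sub (cauchyVec hμ) (η • divOp hμ ψ), Lp.coeFn_smul η (divOp hμ ψ),
    coeFn_cauchyVec hμ, coeFn_divOp hμ ψ] with x h1 h2 h3 h4
  rw [h1, Pi.sub_apply, h2, Pi.smul_apply, h3, h4, smul_eq_mul]

/-! ### Holomorphy of Cauchy integrals -/

/-- Integrability is asked only of the product with the kernel, which covers both `φ̄` in `L²` and
`ψφ̄` in `L¹`. -/
theorem hasDerivAt_cauchyIntegral {h : ℝ → ℂ} (hm : AEStronglyMeasurable h volume)
    {μ : ℂ} (hμ : μ.im ≠ 0) (hi : Integrable fun x : ℝ => 1 / ((x : ℂ) - μ) * h x) :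
    HasDerivAt (fun w : ℂ => ∫ x : ℝ, 1 / ((x : ℂ) - w) * h x)
      (∫ x : ℝ, 1 / ((x : ℂ) - μ) ^ 2 * h x) μ := by
  have hb := abs_pos.mpr hμ
  have key : ∀ w ∈ Metric.ball μ (|μ.im| / 2), |μ.im| / 2 ≤ |w.im| := by
    intro w hw
    have h1 : |w.im - μ.im| < |μ.im| / 2 := by
      have := Complex.abs_im_le_norm (w - μ)
      rw [Metric.mem_ball, dist_eq_norm] at hw
      simpa using this.trans_lt hw
    have h2 := abs_sub_abs_le_abs_sub μ.im w.im
    rw [abs_sub_comm] at h2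
    linarith
  have him : ∀ w ∈ Metric.ball μ (|μ.im| / 2), w.im ≠ 0 := fun w hw => by
    have := key w hw
    exact abs_pos.mp (by linarith)
  refine (hasDerivAt_integral_of_dominated_loc_of_deriv_le
    (F := fun (w : ℂ) (x : ℝ) => 1 / ((x : ℂ) - w) * h x)
    (F' := fun (w : ℂ) (x : ℝ) => 1 / ((x : ℂ) - w) ^ 2 * h x)
    -- On this ball `|x - w|` is at least `|Im μ|/2` and at least `|x - μ|/2`; one factor of `1/|x -
    -- w|²` is bounded by each.
    (bound := fun x : ℝ => (4 / |μ.im|) * ‖1 / ((x : ℂ) - μ) * h x‖)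
    (Metric.ball_mem_nhds μ (half_pos hb)) ?_ hi ?_ ?_ (hi.norm.const_mul _) ?_).2
  · filter_upwards [Metric.ball_mem_nhds μ (half_pos hb)] with w hw
    exact (continuous_cauchyKernel (him w hw)).aestronglyMeasurable.mul hm
  · refine AEStronglyMeasurable.mul ?_ hm
    exact (((continuous_cauchyKernel hμ).pow 2).congr fun x => by simp).aestronglyMeasurable
  · refine Eventually.of_forall fun x w hw => ?_
    have h1 : |μ.im| / 2 ≤ ‖(x : ℂ) - w‖ := (key w hw).trans (abs_im_le_norm_ofReal_sub w x)
    have h2 : ‖(x : ℂ) - μ‖ ≤ 2 * ‖(x : ℂ) - w‖ := by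
      have : ‖(x : ℂ) - μ‖ ≤ ‖(x : ℂ) - w‖ + ‖w - μ‖ := norm_sub_le_norm_sub_add_norm_sub ..
      rw [Metric.mem_ball, dist_eq_norm] at hw
      linarith
    have h3 : 0 < ‖(x : ℂ) - w‖ := by linarith
    have h4 : 0 < ‖(x : ℂ) - μ‖ := norm_pos_iff.mpr (ofReal_sub_ne_zero hμ x)
    rw [norm_mul, norm_mul, ← mul_assoc]
    refine mul_le_mul_of_nonneg_right ?_ (norm_nonneg _)
    rw [norm_div, norm_div, norm_one, norm_pow, div_mul_div_comm,
      div_le_div_iff₀ (by positivity) (by positivity)]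
    nlinarith
  · refine Eventually.of_forall fun x w hw => ?_
    have h1 := ofReal_sub_ne_zero (him w hw) x
    have h2 := ((hasDerivAt_id w).const_sub (x : ℂ)).inv h1
    simp only [id, neg_neg] at h2
    simpa [one_div] using h2.mul_const (h x)

theorem integrable_cauchyKernel_mul_star (φ : L2) {μ : ℂ} (hμ : μ.im ≠ 0) :
    Integrable fun t : ℝ => (1 / ((t : ℂ) - μ)) * (starRingEnd ℂ) (φ t) :=
  integrable_mul_of_memLp_two (memLp_cauchyKernel hμ) (memLp_star (Lp.memLp φ))

theorem halfPlane_im_ne_zero {s : ℤˣ} {μ : ℂ} (h : μ ∈ halfPlane s) : μ.im ≠ 0 := by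
  rintro h0
  simp [halfPlane, h0] at h

theorem differentiableOn_conjCauchy (φ : L2) (s : ℤˣ) :
    DifferentiableOn ℂ (conjCauchy φ) (halfPlane s) := fun _ hμ =>
  (hasDerivAt_cauchyIntegral (memLp_star (Lp.memLp φ)).1 (halfPlane_im_ne_zero hμ)
    (integrable_cauchyKernel_mul_star φ
      (halfPlane_im_ne_zero hμ))).differentiableAt.differentiableWithinAt

theorem differentiableOn_perturbD (φ ψ : L2) (s : ℤˣ) :
    DifferentiableOn ℂ (perturbD φ ψ) (halfPlane s) := by
  intro μ hμ
  have hμ' := halfPlane_im_ne_zero hμ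
  have hm : Integrable fun x : ℝ => ψ x * (starRingEnd ℂ) (φ x) :=
    integrable_mul_of_memLp_two (Lp.memLp ψ) (memLp_star (Lp.memLp φ))
  have := hasDerivAt_cauchyIntegral hm.1 hμ' (hm.bdd_mul
    (continuous_cauchyKernel hμ').aestronglyMeasurable
    (Eventually.of_forall (norm_cauchyKernel_le hμ')))
  simp_rw [← mul_assoc] at this
  exact (this.const_add 1).differentiableAt.differentiableWithinAt

/-! ### The identity theorem on a half-plane -/

theorem isOpen_halfPlane (s : ℤˣ) : IsOpen (halfPlane s) :=
  isOpen_lt continuous_const (by fun_prop)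

theorem convex_halfPlane (s : ℤˣ) : Convex ℝ (halfPlane s) := by
  intro z hz w hw a b ha hb hab
  simp only [halfPlane, Set.mem_ofPred_eq] at hz hw ⊢
  simp only [Complex.add_im, Complex.real_smul, Complex.im_ofReal_mul]
  rcases ha.eq_or_lt with rfl | ha
  · obtain rfl : b = 1 := by linarith
    simpa using hw
  · nlinarith [mul_pos ha hz, mul_nonneg hb hw.le]

/-- The zeros of a holomorphic function that is not identically zero on a connected open set are
isolated there, hence form a null set. -/
theorem eqOn_zero_of_measure_pos {f : ℂ → ℂ} {U A : Set ℂ} (hU : IsOpen U)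
    (hc : IsPreconnected U) (hf : DifferentiableOn ℂ f U) (hA : A ⊆ U) (hpos : 0 < volume A)
    (h0 : ∀ z ∈ A, f z = 0) : ∀ z ∈ U, f z = 0 := by
  intro z hz
  by_contra hne
  have h1 := (hf.analyticOnNhd hU).preimage_zero_mem_codiscreteWithin hne hz ⟨⟨z, hz⟩, hc⟩
  have h2 := ae_restrict_le_codiscreteWithin (μ := volume) hU.measurableSet h1
  rw [mem_ae_iff, Measure.restrict_apply' hU.measurableSet] at h2
  refine hpos.ne' (measure_mono_null (fun w hw => ?_) h2)
  exact ⟨by simpa using h0 w hw, hA hw⟩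

theorem volume_halfPlane_pos (s : ℤˣ) : 0 < volume (halfPlane s) := by
  refine (isOpen_halfPlane s).measure_pos volume ⟨((s : ℤ) : ℂ) * Complex.I, ?_⟩
  rcases Int.units_eq_one_or s with rfl | rfl <;> simp [halfPlane]

/-! ### Traces and the maximal operator in terms of the Cauchy kernel -/

theorem coeFn_smul_cauchyVec_add_divOp {μ : ℂ} (hμ : μ.im ≠ 0) (c : ℂ) (h : L2) :
    ((c • cauchyVec hμ + divOp hμ h : L2) : ℝ → ℂ) =ᵐ[volume]
      fun x => c * (1 / ((x : ℂ) - μ)) + h x / ((x : ℂ) - μ) := by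
  filter_upwards [Lp.coeFn_add (c • cauchyVec hμ) (divOp hμ h), Lp.coeFn_smul c (cauchyVec hμ),
    coeFn_cauchyVec hμ, coeFn_divOp hμ h] with x h1 h2 h3 h4
  rw [h1, Pi.add_apply, h2, Pi.smul_apply, h3, h4, smul_eq_mul]

/-- Elements of the maximal domain are handled in the coordinates `u = (c + h)/(x - μ)` with `c =
c_u` and `h ∈ L²`; the traces and the operator become explicit in `(c, h)`. -/
theorem coeFn_add_smul_of_decomposition {μ : ℂ} (hμ : μ.im ≠ 0) {c : ℂ} {h u : L2}
    (hu : u = c • cauchyVec hμ + divOp hμ h) :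
    ((h + μ • u : L2) : ℝ → ℂ) =ᵐ[volume] fun x => (x : ℂ) * u x - c := by
  have h1 := coeFn_smul_cauchyVec_add_divOp hμ c h
  rw [← hu] at h1
  filter_upwards [h1, Lp.coeFn_add h (μ • u), Lp.coeFn_smul μ u] with x h1 h2 h3
  rw [h2, Pi.add_apply, h3, Pi.smul_apply, smul_eq_mul, h1]
  have := ofReal_sub_ne_zero hμ x
  field_simp
  ring

theorem isTraceConst_of_decomposition {μ : ℂ} (hμ : μ.im ≠ 0) {c : ℂ} {h u : L2}
    (hu : u = c • cauchyVec hμ + divOp hμ h) : IsTraceConst u c :=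
  (Lp.memLp (h + μ • u)).ae_eq (coeFn_add_smul_of_decomposition hμ hu)

theorem gammaTwo_of_decomposition {μ : ℂ} (hμ : μ.im ≠ 0) {c : ℂ} {h : L2} {u : maxDomain}
    (hu : (u : L2) = c • cauchyVec hμ + divOp hμ h) : gammaTwo u = c :=
  (gammaTwo_spec u).unique (isTraceConst_of_decomposition hμ hu)

theorem maxOp_of_decomposition (φ ψ : L2) {μ : ℂ} (hμ : μ.im ≠ 0) {c : ℂ} {h : L2}
    {u : maxDomain} (hu : (u : L2) = c • cauchyVec hμ + divOp hμ h) :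
    maxOp φ ψ u - μ • (u : L2) = h + (inner ℂ φ (u : L2) : ℂ) • ψ := by
  have h1 : (gammaTwo_spec u).toLp (fun x : ℝ => (x : ℂ) * (u : L2) x - gammaTwo u)
      = h + μ • (u : L2) := by
    refine Lp.ext ((MemLp.coeFn_toLp _).trans ?_)
    rw [gammaTwo_of_decomposition hμ hu]
    exact (coeFn_add_smul_of_decomposition hμ hu).symm
  rw [maxOp, h1]
  abel

theorem eq_decomposition (φ ψ : L2) {μ : ℂ} (hμ : μ.im ≠ 0) (u : maxDomain) :
    (u : L2) = gammaTwo u • cauchyVec hμ +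
      divOp hμ (maxOp φ ψ u - μ • (u : L2) - (inner ℂ φ (u : L2) : ℂ) • ψ) := by
  have h1 : maxOp φ ψ u - μ • (u : L2) - (inner ℂ φ (u : L2) : ℂ) • ψ =
      (gammaTwo_spec u).toLp (fun x : ℝ => (x : ℂ) * (u : L2) x - gammaTwo u) - μ • (u : L2) := by
    rw [maxOp]
    abel
  rw [h1]
  set T := (gammaTwo_spec u).toLp (fun x : ℝ => (x : ℂ) * (u : L2) x - gammaTwo u)
  refine Lp.ext (EventuallyEq.trans ?_ (coeFn_smul_cauchyVec_add_divOp hμ _ _).symm)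
  filter_upwards [Lp.coeFn_sub T (μ • (u : L2)), Lp.coeFn_smul μ (u : L2),
    (gammaTwo_spec u).coeFn_toLp] with x h2 h3 h4
  rw [h2, Pi.sub_apply, h3, Pi.smul_apply, smul_eq_mul, h4]
  have := ofReal_sub_ne_zero hμ x
  field_simp
  ring

theorem conj_im_ne_zero {μ : ℂ} (hμ : μ.im ≠ 0) : ((starRingEnd ℂ) μ).im ≠ 0 := by
  simpa using hμ

/-- The functional `h ↦ ∫ h(x) / (x - μ) dx`. -/
def cauchyFunctional {μ : ℂ} (hμ : μ.im ≠ 0) : L2 →L[ℂ] ℂ :=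
  innerSL ℂ (cauchyVec (conj_im_ne_zero hμ))

theorem cauchyFunctional_apply {μ : ℂ} (hμ : μ.im ≠ 0) (h : L2) :
    cauchyFunctional hμ h = ∫ x : ℝ, h x / ((x : ℂ) - μ) := by
  rw [cauchyFunctional, innerSL_apply_apply, L2.inner_def]
  refine integral_congr_ae ?_
  filter_upwards [coeFn_cauchyVec (conj_im_ne_zero hμ)] with x hx
  rw [hx, RCLike.inner_apply]
  simp [div_eq_mul_inv]

theorem integrable_div_ofReal_sub (h : L2) {μ : ℂ} (hμ : μ.im ≠ 0) :
    Integrable fun x : ℝ => h x / ((x : ℂ) - μ) := by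
  simp_rw [div_eq_mul_one_div (h _)]
  exact integrable_mul_of_memLp_two (Lp.memLp h) (memLp_cauchyKernel hμ)

/-- The kernel is not integrable, but its symmetrization `1/(x - μ) + 1/(-x - μ) = 2μ/((x - μ)(x +
μ))` is a product of two `L²` functions. -/
theorem exists_tendsto_integral_cauchyKernel {μ : ℂ} (hμ : μ.im ≠ 0) :
    ∃ L : ℂ, Tendsto (fun R : ℝ => ∫ x in (-R)..R, 1 / ((x : ℂ) - μ)) atTop (𝓝 L) := by
  have hμ' : (-μ).im ≠ 0 := by simpa using hμ
  have hint : Integrable fun x : ℝ => 2 * μ * (1 / ((x : ℂ) - μ) * (1 / ((x : ℂ) - -μ))) :=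
    (integrable_mul_of_memLp_two (memLp_cauchyKernel hμ) (memLp_cauchyKernel hμ')).const_mul _
  refine ⟨_, ((intervalIntegral_tendsto_integral hint tendsto_neg_atTop_atBot
    tendsto_id).div_const 2).congr fun R => ?_⟩
  have hc := continuous_cauchyKernel hμ
  have h1 := intervalIntegral.integral_comp_neg (a := -R) (b := R)
    (fun x : ℝ => 1 / ((x : ℂ) - μ))
  rw [neg_neg] at h1
  have h2 : ∫ x in (-R)..R, 2 * μ * (1 / ((x : ℂ) - μ) * (1 / ((x : ℂ) - -μ))) =
      (∫ x in (-R)..R, 1 / ((x : ℂ) - μ)) + ∫ x in (-R)..R, 1 / (((-x : ℝ) : ℂ) - μ) := by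
    have hc' : Continuous fun x : ℝ => 1 / (((-x : ℝ) : ℂ) - μ) := hc.comp continuous_neg
    rw [← intervalIntegral.integral_add (hc.intervalIntegrable _ _)
      (hc'.intervalIntegrable _ _)]
    congr 1 with x
    have e1 := ofReal_sub_ne_zero hμ x
    have e2 := ofReal_sub_ne_zero hμ' x
    have e3 := ofReal_sub_ne_zero hμ (-x)
    have e4 : (((-x : ℝ) : ℂ) - μ) = -((x : ℂ) - -μ) := by push_cast; ring
    rw [e4, div_neg]
    field_simp
    ring
  simp only [id]
  rw [h2, h1]
  ring

/-- `L` is the principal value of the integral of the kernel, the same for all `u`; the part with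
`h` is absolutely integrable. -/
theorem exists_gammaOne_of_decomposition {μ : ℂ} (hμ : μ.im ≠ 0) :
    ∃ L : ℂ, ∀ (u : maxDomain) (c : ℂ) (h : L2),
      (u : L2) = c • cauchyVec hμ + divOp hμ h →
        gammaOne u = c * L + cauchyFunctional hμ h := by
  obtain ⟨L, hL⟩ := exists_tendsto_integral_cauchyKernel hμ
  refine ⟨L, fun u c h hu => Tendsto.limUnder_eq ?_⟩
  have h1 := intervalIntegral_tendsto_integral (integrable_div_ofReal_sub h hμ)
    tendsto_neg_atTop_atBot tendsto_id
  rw [← cauchyFunctional_apply hμ] at h1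
  refine ((hL.const_mul c).add h1).congr fun R => ?_
  simp only [id]
  rw [← intervalIntegral.integral_const_mul, ← intervalIntegral.integral_add
    (((continuous_cauchyKernel hμ).const_mul c).intervalIntegrable _ _)
    (integrable_div_ofReal_sub h hμ).intervalIntegrable]
  refine intervalIntegral.integral_congr_ae ?_
  have h2 := coeFn_smul_cauchyVec_add_divOp hμ c h
  rw [← hu] at h2
  filter_upwards [h2] with x hx _
  exact hx.symm

/-! ### Solutions of the resolvent equation -/

/-- The solution `1/(x - μ) - η ψ/(x - μ)`, `η = conjCauchy φ μ / perturbD φ ψ μ`, of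
`(Ã* - μ) u = 0`. -/
def defectVec (φ ψ : L2) {μ : ℂ} (hμ : μ.im ≠ 0) : L2 :=
  cauchyVec hμ - (conjCauchy φ μ / perturbD φ ψ μ) • divOp hμ ψ

theorem inner_smul_cauchyVec_add_divOp (φ ψ : L2) {μ : ℂ} (hμ : μ.im ≠ 0) (c k : ℂ) (g : L2) :
    (inner ℂ φ (c • cauchyVec hμ + divOp hμ (g - k • ψ)) : ℂ) =
      c * conjCauchy φ μ + inner ℂ φ (divOp hμ g) - k * (perturbD φ ψ μ - 1) := by
  rw [map_sub, map_smul, inner_add_right, inner_sub_right, inner_smul_right, inner_smul_right,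
    inner_cauchyVec, inner_divOp φ ψ]
  ring

/-- The part of the resolvent of `A_B` at `μ` which does not depend on `B`. -/
def freeResolvent (φ ψ : L2) {μ : ℂ} (hμ : μ.im ≠ 0) : L2 →L[ℂ] L2 :=
  ContinuousLinearMap.id ℂ L2 -
    (((perturbD φ ψ μ)⁻¹ • innerSL ℂ φ).comp (divOp hμ)).smulRight ψ

theorem freeResolvent_apply (φ ψ : L2) {μ : ℂ} (hμ : μ.im ≠ 0) (g : L2) :
    freeResolvent φ ψ hμ g =
      g - ((inner ℂ φ (divOp hμ g) : ℂ) / perturbD φ ψ μ) • ψ := by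
  simp [freeResolvent, div_eq_inv_mul]

theorem smul_defectVec_add (φ ψ : L2) {μ : ℂ} (hμ : μ.im ≠ 0) (c : ℂ) (g : L2) :
    c • defectVec φ ψ hμ + divOp hμ (freeResolvent φ ψ hμ g) =
      c • cauchyVec hμ + divOp hμ (g -
        ((c * conjCauchy φ μ + inner ℂ φ (divOp hμ g)) / perturbD φ ψ μ) • ψ) := by
  rw [defectVec, freeResolvent_apply, map_sub, map_sub, map_smul, map_smul]
  module

theorem maxOp_smul_defectVec_add (φ ψ : L2) {μ : ℂ} (hμ : μ.im ≠ 0) (hD : perturbD φ ψ μ ≠ 0)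
    (c : ℂ) (g : L2) {u : maxDomain}
    (hu : (u : L2) = c • defectVec φ ψ hμ + divOp hμ (freeResolvent φ ψ hμ g)) :
    maxOp φ ψ u - μ • (u : L2) = g := by
  rw [smul_defectVec_add] at hu
  rw [maxOp_of_decomposition φ ψ hμ hu, hu, inner_smul_cauchyVec_add_divOp]
  match_scalars
  · ring
  · field_simp
    ring

/-- Pairing the decomposition of `u` with `φ` gives an equation for `k = ⟨u, φ⟩` in which `k` has
total coefficient `D(μ)`. Hence `u` is determined by `c_u` and `(Ã* - μ)u`. -/
theorem eq_smul_defectVec_add (φ ψ : L2) {μ : ℂ} (hμ : μ.im ≠ 0) (hD : perturbD φ ψ μ ≠ 0)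
    (u : maxDomain) :
    (u : L2) = gammaTwo u • defectVec φ ψ hμ +
      divOp hμ (freeResolvent φ ψ hμ (maxOp φ ψ u - μ • (u : L2))) := by
  have h1 := eq_decomposition φ ψ hμ u
  set g := maxOp φ ψ u - μ • (u : L2)
  set k : ℂ := inner ℂ φ (u : L2)
  have h2 : k = gammaTwo u * conjCauchy φ μ + inner ℂ φ (divOp hμ g)
      - k * (perturbD φ ψ μ - 1) := by
    rw [← inner_smul_cauchyVec_add_divOp, ← h1]
  rw [smul_defectVec_add, h1]
  have h3 : k = (gammaTwo u * conjCauchy φ μ + inner ℂ φ (divOp hμ g)) / perturbD φ ψ μ := by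
    rw [eq_div_iff hD]
    linear_combination h2
  rw [← h3, ← h1]

/-- The solutions of `(Ã* - μ)u = g` form a line parametrized by `c = c_u`. The boundary condition
on it is a linear equation in `c` with coefficient `m - B`, where `m` is `Γ₁` of the defect vector.
-/
theorem exists_mem_resolventSetOp (φ ψ : L2) {μ : ℂ} (hμ : μ.im ≠ 0)
    (hD : perturbD φ ψ μ ≠ 0) : ∃ B : ℂ, μ ∈ resolventSetOp φ ψ B := by
  obtain ⟨L, hL⟩ := exists_gammaOne_of_decomposition hμ
  let V := freeResolvent φ ψ hμ
  let η := conjCauchy φ μ / perturbD φ ψ μ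
  let m := L - η * cauchyFunctional hμ ψ
  have hγ1 : ∀ (u : maxDomain) (c : ℂ) (g : L2),
      (u : L2) = c • defectVec φ ψ hμ + divOp hμ (V g) →
        gammaOne u = c * m + cauchyFunctional hμ (V g) := by
    intro u c g hu
    have h1 : (u : L2) = c • cauchyVec hμ + divOp hμ (V g - (c * η) • ψ) := by
      rw [hu, defectVec, map_sub, map_smul]
      module
    rw [hL u _ _ h1, map_sub, map_smul, smul_eq_mul]
    ring
  have hγ2 : ∀ (u : maxDomain) (c : ℂ) (g : L2),
      (u : L2) = c • defectVec φ ψ hμ + divOp hμ (V g) → gammaTwo u = c := by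
    intro u c g hu
    rw [smul_defectVec_add] at hu
    exact gammaTwo_of_decomposition hμ hu
  let J : L2 →L[ℂ] ℂ := -(cauchyFunctional hμ).comp V
  have hJ : ∀ g, J g = -cauchyFunctional hμ (V g) := fun g => rfl
  -- Any `B ≠ m` would do; `B = m - 1` makes the coefficient of `c` equal to 1, so that `c = J g`.
  refine ⟨m - 1, J.smulRight (defectVec φ ψ hμ) + (divOp hμ).comp V, fun g => ?_,
    fun u hu => ?_⟩
  · have hdom : J g • defectVec φ ψ hμ + divOp hμ (V g) ∈ maxDomain :=
      ⟨J g, isTraceConst_of_decomposition hμ (smul_defectVec_add φ ψ hμ (J g) g)⟩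
    refine ⟨⟨_, hdom⟩, rfl, ?_, maxOp_smul_defectVec_add φ ψ hμ hD (J g) g rfl⟩
    rw [InDomain, hγ1 ⟨_, hdom⟩ (J g) g rfl, hγ2 ⟨_, hdom⟩ (J g) g rfl, hJ]
    ring
  · have h1 := eq_smul_defectVec_add φ ψ hμ hD u
    set g := maxOp φ ψ u - μ • (u : L2)
    have h2 : gammaTwo u = J g := by
      rw [InDomain, hγ1 u _ g h1] at hu
      rw [hJ]
      linear_combination hu
    rw [h1, h2]
    rfl

theorem defectVec_mem_detectable (φ ψ : L2) {μ : ℂ} (hμ : μ.im ≠ 0)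
    (hD : perturbD φ ψ μ ≠ 0) : defectVec φ ψ hμ ∈ detectable φ ψ := by
  obtain ⟨B, hB⟩ := exists_mem_resolventSetOp φ ψ hμ hD
  have h0 : defectVec φ ψ hμ =
      (1 : ℂ) • defectVec φ ψ hμ + divOp hμ (freeResolvent φ ψ hμ 0) := by
    simp
  have hdom : defectVec φ ψ hμ ∈ maxDomain :=
    ⟨1, isTraceConst_of_decomposition hμ (h0.trans (smul_defectVec_add φ ψ hμ 1 0))⟩
  refine Submodule.le_topologicalClosure _ (Submodule.mem_iSup_of_mem B
    (Submodule.subset_span (Set.mem_iUnion₂_of_mem hB ?_)))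
  exact ⟨_, ⟨_, hdom⟩, maxOp_smul_defectVec_add φ ψ hμ hD 1 0 h0, rfl, rfl⟩

/-! ### Recovering the ratio from the detectable subspace -/

/-- Subtracting the defect vector from a candidate with another `η` leaves a nonzero multiple of
`ψ/(x - μ)`; adding this back yields `1/(x - μ)`, against `μ ∉ Ω`. -/
theorem eq_ratio_iff_sub_mem_detectable (φ ψ : L2) {μ : ℂ} (hμ : μ.im ≠ 0)
    (hD : perturbD φ ψ μ ≠ 0) (hΩ : μ ∉ nonUniq φ ψ) (η : ℂ) :
    cauchyVec hμ - η • divOp hμ ψ ∈ detectable φ ψ ↔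
      η = conjCauchy φ μ / perturbD φ ψ μ := by
  have hdef := defectVec_mem_detectable φ ψ hμ hD
  refine ⟨fun h => ?_, ?_⟩
  · by_contra hne
    apply hΩ
    have h1 := (detectable φ ψ).sub_mem h hdef
    rw [defectVec, sub_sub_sub_cancel_left, ← sub_smul,
      Submodule.smul_mem_iff _ (sub_ne_zero.mpr (Ne.symm hne))] at h1
    refine ⟨hμ, (funMem_cauchyKernel_iff hμ _).mpr ?_, (funMem_div_iff ψ hμ _).mpr h1⟩
    simpa using (detectable φ ψ).add_mem h ((detectable φ ψ).smul_mem η h1)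
  · rintro rfl
    exact hdef

theorem ratio_eq_of_detectable_eq (φ φ' ψ : L2) (s : ℤˣ)
    (hpos : 0 < volume (halfPlane s \ nonUniq φ ψ)) (hS : detectable φ' ψ = detectable φ ψ)
    {μ : ℂ} (hμ : μ ∈ halfPlane s) (hD : perturbD φ ψ μ ≠ 0) (hD' : perturbD φ' ψ μ ≠ 0) :
    conjCauchy φ' μ / perturbD φ' ψ μ = conjCauchy φ μ / perturbD φ ψ μ := by
  have hΩ : nonUniq φ' ψ = nonUniq φ ψ := by rw [nonUniq, nonUniq, hS]
  have hd := differentiableOn_perturbD φ ψ s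
  have hd' := differentiableOn_perturbD φ' ψ s
  -- The extra factor `D D'` makes the function vanish also at points of the uniqueness set where a
  -- denominator is zero, so that these need no separate measure argument.
  have key := eqOn_zero_of_measure_pos (isOpen_halfPlane s) (convex_halfPlane s).isPreconnected
    ((((differentiableOn_conjCauchy φ' s).mul hd).sub
      ((differentiableOn_conjCauchy φ s).mul hd')).mul (hd.mul hd')) Set.sdiff_subset hpos
    (fun z hz => ?_) μ hμ
  · have h1 := (mul_eq_zero.mp key).resolve_right (mul_ne_zero hD hD')
    rw [div_eq_div_iff hD' hD]
    exact sub_eq_zero.mp h1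
  · by_cases h1 : perturbD φ ψ z = 0
    · simp [h1]
    by_cases h2 : perturbD φ' ψ z = 0
    · simp [h2]
    have hz' := halfPlane_im_ne_zero hz.1
    have h3 := (eq_ratio_iff_sub_mem_detectable φ ψ hz' h1 hz.2 _).mp
      (hS ▸ defectVec_mem_detectable φ' ψ hz' h2)
    rw [div_eq_div_iff h2 h1] at h3
    simp [h3]

/-! ### Pointwise bounds for Hardy functions -/

/-- Mean value property, with the angle moved to `(-π, π)` to match polar coordinates. -/
theorem two_pi_mul_enorm_le_lintegral_circle {G : ℂ → ℂ} {r ρ : ℝ}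
    (hG : DifferentiableOn ℂ G (Metric.ball 0 r)) (hρ : 0 < ρ) (hρr : ρ < r) :
    ENNReal.ofReal (2 * Real.pi) * ‖G 0‖ₑ ≤
      ∫⁻ θ in Set.Ioo (-Real.pi) Real.pi,
        ‖G (ρ * (Real.cos θ + Real.sin θ * Complex.I))‖ₑ := by
  have hcl : Metric.closedBall (0 : ℂ) |ρ| ⊆ Metric.ball 0 r := by
    rw [abs_of_pos hρ]
    exact Metric.closedBall_subset_ball hρr
  have h1 : Real.circleAverage G 0 ρ = G 0 := by
    refine DiffContOnCl.circleAverage (DifferentiableOn.diffContOnCl (hG.mono ?_))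
    exact Metric.closure_ball_subset_closedBall.trans hcl
  have hper := (periodic_circleMap (0 : ℂ) ρ).comp G
  have h2 : ∫ θ in (0 : ℝ)..(2 * Real.pi), G (circleMap 0 ρ θ) =
      ∫ θ in (-Real.pi)..Real.pi, G (circleMap 0 ρ θ) := by
    have := hper.intervalIntegral_add_eq 0 (-Real.pi)
    rw [zero_add, show -Real.pi + 2 * Real.pi = Real.pi by ring] at this
    exact this
  have h3 : (2 * Real.pi : ℝ) • G 0 = ∫ θ in Set.Ioo (-Real.pi) Real.pi,
      G (ρ * (Real.cos θ + Real.sin θ * Complex.I)) := by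
    rw [← h1, Real.circleAverage_def, smul_smul, mul_inv_cancel₀ (by positivity), one_smul, h2,
      intervalIntegral.integral_of_le (by linarith [Real.pi_pos]), integral_Ioc_eq_integral_Ioo]
    simp only [circleMap, zero_add, Complex.exp_mul_I, Complex.ofReal_cos, Complex.ofReal_sin]
  calc ENNReal.ofReal (2 * Real.pi) * ‖G 0‖ₑ = ‖(2 * Real.pi : ℝ) • G 0‖ₑ := by
        rw [enorm_smul, Real.enorm_of_nonneg (by positivity)]
    _ ≤ _ := by
        rw [h3]
        exact enorm_integral_le_lintegral_enorm _

/-- The circle estimate is integrated over `r/2 < ρ < r` only: one factor `r/2` bounds the Jacobian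
from below, the other is the length of the interval. -/
theorem enorm_le_lintegral_ball {G : ℂ → ℂ} {r : ℝ} (hr : 0 < r)
    (hG : DifferentiableOn ℂ G (Metric.ball 0 r)) :
    ENNReal.ofReal (r / 2) * (ENNReal.ofReal (2 * Real.pi) * ‖G 0‖ₑ) * ENNReal.ofReal (r / 2) ≤
      ∫⁻ w in Metric.ball 0 r, ‖G w‖ₑ := by
  classical
  set f : ℂ → ENNReal := (Metric.ball 0 r).indicator fun w => ‖G w‖ₑ with hf
  have hfm : Measurable f := by
    have hc : ContinuousOn (fun w => ‖G w‖ₑ) (Metric.ball 0 r) := hG.continuousOn.enorm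
    rw [hf, ← Set.piecewise_eq_indicator]
    exact hc.measurable_piecewise continuousOn_const measurableSet_ball
  rw [← lintegral_indicator measurableSet_ball, ← hf, ← Complex.lintegral_comp_polarCoord_symm,
    polarCoord_target, Measure.volume_eq_prod, ← Measure.prod_restrict, lintegral_prod]
  swap
  · simp_rw [Complex.polarCoord_symm_apply, smul_eq_mul]
    refine (Measurable.mul (by fun_prop) (hfm.comp ?_)).aemeasurable
    fun_prop
  calc _ = ∫⁻ ρ in Set.Ioo (r / 2) r,
        ENNReal.ofReal (r / 2) * (ENNReal.ofReal (2 * Real.pi) * ‖G 0‖ₑ) := by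
        rw [setLIntegral_const, Real.volume_Ioo, sub_half]
    _ ≤ ∫⁻ ρ in Set.Ioo (r / 2) r, ∫⁻ θ in Set.Ioo (-Real.pi) Real.pi,
        ENNReal.ofReal ρ • f (Complex.polarCoord.symm (ρ, θ)) := by
        refine setLIntegral_mono' measurableSet_Ioo fun ρ hρ => ?_
        have hρ0 : 0 < ρ := (half_pos hr).trans hρ.1
        simp_rw [smul_eq_mul]
        rw [lintegral_const_mul' _ _ ENNReal.ofReal_ne_top]
        refine mul_le_mul' (ENNReal.ofReal_le_ofReal hρ.1.le)
          ((two_pi_mul_enorm_le_lintegral_circle hG hρ0 hρ.2).trans (le_of_eq ?_))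
        refine lintegral_congr fun θ => ?_
        rw [Complex.polarCoord_symm_apply, hf, Set.indicator_of_mem]
        have := Complex.norm_polarCoord_symm (ρ, θ)
        rw [Complex.polarCoord_symm_apply] at this
        rw [mem_ball_zero_iff, this, abs_of_pos hρ0]
        exact hρ.2
    _ ≤ _ := lintegral_mono_set fun ρ hρ => (half_pos hr).trans hρ.1

/-- Fubini over horizontal slices of the strip `|Im w| < r`, which contains the ball. -/
theorem lintegral_ball_le {F : ℂ → ENNReal} {r : ℝ} {C : ENNReal}
    (hm : Measurable ((Metric.ball 0 r).indicator F))
    (hC : ∀ y ∈ Set.Ioo (-r) r, ∫⁻ x : ℝ, F (x + y * Complex.I) ≤ C) :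
    ∫⁻ w in Metric.ball 0 r, F w ≤ C * ENNReal.ofReal (2 * r) := by
  rw [← lintegral_indicator measurableSet_ball,
    ← (Complex.volume_preserving_equiv_real_prod.symm).lintegral_comp_emb
      Complex.measurableEquivRealProd.symm.measurableEmbedding, Measure.volume_eq_prod,
    lintegral_prod_symm (fun p => (Metric.ball 0 r).indicator F
      (Complex.measurableEquivRealProd.symm p))
      (hm.comp Complex.measurableEquivRealProd.symm.measurable).aemeasurable]
  calc _ ≤ ∫⁻ y : ℝ, (Set.Ioo (-r) r).indicator (fun _ => C) y := by
        refine lintegral_mono fun y => ?_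
        by_cases hy : y ∈ Set.Ioo (-r) r
        · rw [Set.indicator_of_mem hy]
          refine le_trans (lintegral_mono fun x => ?_) (hC y hy)
          refine (Set.indicator_le_self _ _ _).trans (le_of_eq ?_)
          rw [Complex.measurableEquivRealProd_symm_apply, Complex.mk_eq_add_mul_I]
        · rw [Set.indicator_of_notMem hy, nonpos_iff_eq_zero, lintegral_eq_zero_of_ae_eq_zero]
          refine Eventually.of_forall fun x => Set.indicator_of_notMem (fun hx => hy ?_) _
          rw [mem_ball_zero_iff] at hx
          have := (Complex.abs_im_le_norm _).trans_lt hx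
          rw [Complex.measurableEquivRealProd_symm_apply] at this
          exact abs_lt.mp this
    _ = _ := by
        rw [lintegral_indicator_const measurableSet_Ioo, Real.volume_Ioo, sub_neg_eq_add, two_mul]

/-- The area estimate is applied to the holomorphic function `F²` on the disc of radius `δ` about
`z`, which stays in the half-plane; the line bounds control the integral. -/
theorem exists_norm_le_of_lintegral_sq_le {F : ℂ → ℂ}
    (hF : DifferentiableOn ℂ F {z | 0 < z.im}) {C : ENNReal} (hCt : C ≠ ⊤)
    (hC : ∀ y : ℝ, 0 < y → ∫⁻ x : ℝ, ‖F (x + y * Complex.I)‖ₑ ^ 2 ≤ C) {δ : ℝ} (hδ : 0 < δ) :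
    ∃ M : ℝ, ∀ z : ℂ, δ ≤ z.im → ‖F z‖ ≤ M := by
  classical
  set A : ENNReal := ENNReal.ofReal (δ / 2) * ENNReal.ofReal (2 * Real.pi) *
    ENNReal.ofReal (δ / 2) with hA
  have hA0 : A ≠ 0 := by
    simp only [hA, ne_eq, mul_eq_zero, ENNReal.ofReal_eq_zero, not_or, not_le]
    exact ⟨⟨by positivity, by positivity⟩, by positivity⟩
  have hAt : A ≠ ⊤ := by finiteness
  set K : ENNReal := C * ENNReal.ofReal (2 * δ) / A with hK
  have hKt : K ≠ ⊤ := ENNReal.div_ne_top (by finiteness) hA0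
  refine ⟨Real.sqrt K.toReal, fun z hz => Real.le_sqrt_of_sq_le ?_⟩
  have hsub : ∀ w ∈ Metric.ball (0 : ℂ) δ, 0 < (z + w).im := by
    intro w hw
    rw [mem_ball_zero_iff] at hw
    have := neg_le_of_abs_le ((Complex.abs_im_le_norm w).trans hw.le)
    have h2 := (Complex.abs_im_le_norm w).trans_lt hw
    have h3 := (abs_lt.mp h2).1
    rw [Complex.add_im]
    linarith
  have hG : DifferentiableOn ℂ (fun w => F (z + w) ^ 2) (Metric.ball 0 δ) :=
    (hF.comp (by fun_prop) hsub).pow 2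
  have h1 := enorm_le_lintegral_ball hδ hG
  have h2 : ∫⁻ w in Metric.ball 0 δ, ‖F (z + w) ^ 2‖ₑ ≤ C * ENNReal.ofReal (2 * δ) := by
    refine lintegral_ball_le ?_ fun y hy => ?_
    · have hc : ContinuousOn (fun w => ‖F (z + w) ^ 2‖ₑ) (Metric.ball 0 δ) :=
        hG.continuousOn.enorm
      rw [← Set.piecewise_eq_indicator]
      exact hc.measurable_piecewise continuousOn_const measurableSet_ball
    · refine le_trans (le_of_eq ?_) (hC (z.im + y) (by linarith [hy.1]))
      rw [← lintegral_add_left_eq_self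
        (fun x : ℝ => ‖F (x + (z.im + y : ℝ) * Complex.I)‖ₑ ^ 2) z.re]
      refine lintegral_congr fun x => ?_
      rw [enorm_pow]
      congr 3
      conv_lhs => rw [← Complex.re_add_im z]
      push_cast
      ring
  have h3 : ‖F z‖ₑ ^ 2 ≤ K := by
    rw [hK, ENNReal.le_div_iff_mul_le (Or.inl hA0) (Or.inl hAt)]
    refine le_trans (le_of_eq ?_) (h1.trans h2)
    rw [hA, add_zero, enorm_pow]
    ring
  have h4 := ENNReal.toReal_mono hKt h3
  simpa using h4

/-! ### The Cauchy formula in a half-plane -/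

theorem integral_real_eq_zero_of_bound {k : ℂ → ℂ} {U : Set ℂ} (hU : {z : ℂ | 0 ≤ z.im} ⊆ U)
    (hk : DifferentiableOn ℂ k U) (hi : Integrable fun t : ℝ => k t) {M R₀ : ℝ}
    (hM : ∀ w : ℂ, 0 ≤ w.im → R₀ ≤ ‖w‖ → ‖k w‖ * ‖w‖ ^ 2 ≤ M) : ∫ t : ℝ, k t = 0 := by
  have hlim := intervalIntegral_tendsto_integral hi tendsto_neg_atTop_atBot tendsto_id
  refine tendsto_nhds_unique hlim ?_
  -- The sides of the rectangle `[-R, R] × [0, R]` off the real axis have total length `4R`, and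
  -- `|k| ≤ M/R²` on them.
  have hz : Tendsto (fun R : ℝ => 4 * M / R) atTop (𝓝 0) := tendsto_const_nhds.div_atTop tendsto_id
  refine squeeze_zero_norm' ?_ hz
  filter_upwards [eventually_ge_atTop R₀, eventually_gt_atTop 0] with R hR hR0
  have hb : ∀ w : ℂ, 0 ≤ w.im → R ≤ ‖w‖ → ‖k w‖ ≤ M / R ^ 2 := by
    intro w hw hwR
    rw [le_div_iff₀ (by positivity)]
    refine le_trans ?_ (hM w hw (hR.trans hwR))
    gcongr
  have hrect := Complex.integral_boundary_rect_eq_zero_of_differentiableOn k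
    (-R : ℝ) (R + R * Complex.I) (hk.mono fun w hw => hU ?_)
  swap
  · have := hw.2
    simp [Set.uIcc_of_le hR0.le] at this
    exact this.1
  simp only [Complex.ofReal_re, Complex.ofReal_im, Complex.add_re, Complex.mul_re, Complex.I_re,
    mul_zero, Complex.I_im, mul_one, sub_self, add_zero, Complex.add_im, Complex.mul_im, zero_add,
    Complex.ofReal_zero, zero_mul] at hrect
  have htop : ‖∫ x : ℝ in (-R)..R, k (x + R * Complex.I)‖ ≤ M / R ^ 2 * |R - -R| := by
    refine intervalIntegral.norm_integral_le_of_norm_le_const fun x _ =>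
      hb _ (by simpa using hR0.le) ?_
    have := (le_abs_self _).trans (Complex.abs_im_le_norm ((x : ℂ) + R * Complex.I))
    simpa using this
  have hside : ∀ a : ℝ, |a| = R →
      ‖∫ y : ℝ in (0 : ℝ)..R, k (a + y * Complex.I)‖ ≤ M / R ^ 2 * |R - 0| := by
    intro a ha
    refine intervalIntegral.norm_integral_le_of_norm_le_const fun y hy => hb _ ?_ ?_
    · rw [Set.uIoc_of_le hR0.le] at hy
      simpa using hy.1.le
    · have := Complex.abs_re_le_norm ((a : ℂ) + y * Complex.I)
      simpa [ha] using this
  have hr := hside R (abs_of_pos hR0)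
  have hl := hside (-R) (by rw [abs_neg, abs_of_pos hR0])
  set bot := ∫ x : ℝ in (-R)..R, k x
  set top := ∫ x : ℝ in (-R)..R, k (x + R * Complex.I)
  set right := ∫ y : ℝ in (0 : ℝ)..R, k ((R : ℝ) + y * Complex.I)
  set left := ∫ y : ℝ in (0 : ℝ)..R, k ((-R : ℝ) + y * Complex.I)
  have heq : bot = top - Complex.I • right + Complex.I • left := by
    linear_combination hrect
  have h1 : ‖bot‖ ≤ ‖top‖ + ‖right‖ + ‖left‖ := by
    rw [heq]
    refine (norm_add_le _ _).trans (add_le_add ((norm_sub_le _ _).trans ?_) ?_) <;>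
      simp
  rw [sub_zero, abs_of_pos hR0] at hr hl
  rw [sub_neg_eq_add, abs_of_pos (by linarith)] at htop
  refine h1.trans ((add_le_add (add_le_add htop hr) hl).trans (le_of_eq ?_))
  field_simp
  ring

theorem sub_conj_div_eq (ζ : ℂ) (t : ℝ) :
    (ζ - (starRingEnd ℂ) ζ) / (((t : ℂ) - ζ) * ((t : ℂ) - (starRingEnd ℂ) ζ)) =
      2 * ζ.im * Complex.I * ((1 / ((t - ζ.re) ^ 2 + ζ.im ^ 2) : ℝ) : ℂ) := by
  have h1 : ((t : ℂ) - ζ) * ((t : ℂ) - (starRingEnd ℂ) ζ) =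
      (((t - ζ.re) ^ 2 + ζ.im ^ 2 : ℝ) : ℂ) := by
    have := Complex.mul_conj ((t : ℂ) - ζ)
    rw [map_sub, Complex.conj_ofReal] at this
    rw [this, ← normSq_ofReal_sub, Complex.normSq_eq_norm_sq]
  rw [h1, Complex.sub_conj, Complex.ofReal_div, Complex.ofReal_one]
  push_cast
  ring

/-- Subtracting `H(ζ)(ζ - ζ̄)/(w - ζ̄)` from `H` creates a zero at `ζ`, adds no pole in the closed
half-plane, and keeps the decay `1/|w|`. Dividing by `w - ζ` gives a function of order `|w|⁻²` with
integral zero; the subtracted term contributes a multiple of the Poisson kernel. -/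
theorem cauchy_formula_halfPlane {H : ℂ → ℂ} {U : Set ℂ} (hUo : IsOpen U)
    (hU : {z : ℂ | 0 ≤ z.im} ⊆ U) (hH : DifferentiableOn ℂ H U)
    (hi : Integrable fun t : ℝ => H t) {M : ℝ}
    (hM : ∀ w : ℂ, 0 ≤ w.im → ‖H w‖ * ‖w‖ ≤ M) {ζ : ℂ} (hζ : 0 < ζ.im) :
    ∫ t : ℝ, 1 / ((t : ℂ) - ζ) * H t = 2 * Real.pi * Complex.I * H ζ := by
  set ζ' := (starRingEnd ℂ) ζ with hζ'
  have hne : ∀ w : ℂ, 0 ≤ w.im → w - ζ' ≠ 0 := by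
    intro w hw h
    have := congrArg Complex.im h
    simp [hζ'] at this
    linarith
  let V : Set ℂ := U ∩ {w | w ≠ ζ'}
  have hVo : IsOpen V := hUo.inter isOpen_ne
  have hUV : {z : ℂ | 0 ≤ z.im} ⊆ V := fun w hw => ⟨hU hw, sub_ne_zero.mp (hne w hw)⟩
  let Q : ℂ → ℂ := fun w => H w - H ζ * ((ζ - ζ') / (w - ζ'))
  have hQ0 : Q ζ = 0 := by
    simp only [Q]
    rw [div_self (hne ζ hζ.le)]
    ring
  have hQ : DifferentiableOn ℂ Q V := by
    refine (hH.mono Set.inter_subset_left).sub (DifferentiableOn.const_mul ?_ _)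
    exact (differentiableOn_const _).div (by fun_prop) fun w hw => sub_ne_zero.mpr hw.2
  have hk : DifferentiableOn ℂ (dslope Q ζ) V :=
    (Complex.differentiableOn_dslope (hVo.mem_nhds (hUV hζ.le))).mpr hQ
  have hform : ∀ w : ℂ, w ≠ ζ → dslope Q ζ w =
      1 / (w - ζ) * H w - H ζ * ((ζ - ζ') / ((w - ζ) * (w - ζ'))) := by
    intro w hw
    rw [dslope_of_ne _ hw, slope_def_field, hQ0, sub_zero]
    simp only [Q]
    rw [sub_div, mul_div_assoc, div_div, mul_comm (w - ζ'), one_div_mul_eq_div]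
  have hreal : ∀ t : ℝ, dslope Q ζ t = 1 / ((t : ℂ) - ζ) * H t -
      H ζ * (2 * ζ.im * Complex.I * ((1 / ((t - ζ.re) ^ 2 + ζ.im ^ 2) : ℝ) : ℂ)) := by
    intro t
    rw [hform _ (sub_ne_zero.mp (ofReal_sub_ne_zero hζ.ne' t)), sub_conj_div_eq]
  have hi1 : Integrable fun t : ℝ => 1 / ((t : ℂ) - ζ) * H t :=
    hi.bdd_mul (continuous_cauchyKernel hζ.ne').aestronglyMeasurable
      (Eventually.of_forall (norm_cauchyKernel_le hζ.ne'))
  have hi2 : Integrable fun t : ℝ =>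
      H ζ * (2 * ζ.im * Complex.I * ((1 / ((t - ζ.re) ^ 2 + ζ.im ^ 2) : ℝ) : ℂ)) :=
    ((integrable_poissonKernel hζ.ne').ofReal.const_mul _).const_mul _
  have hzero : ∫ t : ℝ, dslope Q ζ t = 0 := by
    -- For `|w| ≥ 2|ζ| + 1`, both `|w - ζ|` and `|w - ζ̄|` are at least `|w|/2`, whence the factors
    -- 2 and 4.
    refine integral_real_eq_zero_of_bound (R₀ := 2 * ‖ζ‖ + 1)
      (M := 2 * M + ‖H ζ‖ * (‖ζ - ζ'‖ * 4)) hUV hk ?_ fun w hw hwR => ?_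
    · simp_rw [hreal]
      exact hi1.sub hi2
    · have hζn := norm_nonneg ζ
      have hnc : ‖ζ'‖ = ‖ζ‖ := RCLike.norm_conj ζ
      have hw0 : 0 < ‖w‖ := by linarith
      have e1 : ‖w‖ ≤ 2 * ‖w - ζ‖ := by
        have := norm_sub_norm_le w ζ
        linarith
      have e2 : ‖w‖ ≤ 2 * ‖w - ζ'‖ := by
        have := norm_sub_norm_le w ζ'
        linarith
      have e3 : 0 < ‖w - ζ‖ := by linarith
      have e4 : 0 < ‖w - ζ'‖ := by linarith
      have f1 : ‖1 / (w - ζ) * H w‖ * ‖w‖ ^ 2 ≤ 2 * M := by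
        rw [norm_mul, norm_div, norm_one]
        have : 1 / ‖w - ζ‖ * ‖w‖ ≤ 2 := by
          rw [one_div_mul_eq_div, div_le_iff₀ e3]
          exact e1
        calc 1 / ‖w - ζ‖ * ‖H w‖ * ‖w‖ ^ 2
            = (1 / ‖w - ζ‖ * ‖w‖) * (‖H w‖ * ‖w‖) := by ring
          _ ≤ 2 * M := mul_le_mul this (hM w hw) (by positivity) (by norm_num)
      have f2 : ‖H ζ * ((ζ - ζ') / ((w - ζ) * (w - ζ')))‖ * ‖w‖ ^ 2 ≤
          ‖H ζ‖ * (‖ζ - ζ'‖ * 4) := by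
        rw [norm_mul, norm_div, norm_mul, mul_assoc]
        refine mul_le_mul_of_nonneg_left ?_ (norm_nonneg _)
        rw [div_mul_eq_mul_div, mul_div_assoc]
        refine mul_le_mul_of_nonneg_left ?_ (norm_nonneg _)
        rw [div_le_iff₀ (by positivity)]
        nlinarith
      rw [hform w (fun h => by simp [h] at e3)]
      refine (mul_le_mul_of_nonneg_right (norm_sub_le _ _) (by positivity)).trans ?_
      rw [add_mul]
      exact add_le_add f1 f2
  simp_rw [hreal] at hzero
  rw [integral_sub hi1 hi2, sub_eq_zero, integral_const_mul, integral_const_mul,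
    integral_complex_ofReal, integral_poissonKernel hζ.ne', abs_of_pos hζ] at hzero
  rw [hzero]
  have : (ζ.im : ℂ) ≠ 0 := by exact_mod_cast hζ.ne'
  push_cast
  field_simp

/-! ### Pairing Hardy functions with the annihilator of the Cauchy kernels -/

/-- The bound does not depend on `Re μ`, as needed for Fubini with the pole moving along a
horizontal line. -/
theorem integral_norm_cauchyKernel_mul_le {g : ℝ → ℂ} (hg : MemLp g 2 volume) {μ : ℂ}
    (hμ : μ.im ≠ 0) :
    ∫ x : ℝ, ‖1 / ((x : ℂ) - μ) * g x‖ ≤ Real.pi / |μ.im| + ∫ x : ℝ, ‖g x‖ ^ 2 := by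
  have h1 := integrable_poissonKernel hμ
  have h2 : Integrable fun x : ℝ => ‖g x‖ ^ 2 :=
    (memLp_two_iff_integrable_sq_norm hg.1).mp hg
  rw [← integral_poissonKernel hμ, ← integral_add h1 h2]
  refine integral_mono (integrable_mul_of_memLp_two (memLp_cauchyKernel hμ) hg).norm
    (h1.add h2) fun x => ?_
  have e : 1 / ((x - μ.re) ^ 2 + μ.im ^ 2) = ‖1 / ((x : ℂ) - μ)‖ ^ 2 := by
    rw [norm_div, norm_one, div_pow, one_pow, normSq_ofReal_sub]
  rw [e, norm_mul]
  nlinarith [sq_nonneg (‖1 / ((x : ℂ) - μ)‖ - ‖g x‖), sq_nonneg ‖1 / ((x : ℂ) - μ)‖,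
    sq_nonneg ‖g x‖]

/-- As a function of `x` the kernel is minus a Cauchy kernel with pole `t - iδ` in the lower
half-plane, which `g` annihilates; Fubini lets the `x` integral be taken first. -/
theorem integral_cauchyIntegral_mul_eq_zero {h g : ℝ → ℂ} (hh : Integrable h)
    (hg : MemLp g 2 volume)
    (horth : ∀ μ : ℂ, μ.im < 0 → ∫ x : ℝ, 1 / ((x : ℂ) - μ) * g x = 0) {δ : ℝ} (hδ : 0 < δ) :
    ∫ x : ℝ, (∫ t : ℝ, 1 / ((t : ℂ) - (x + δ * Complex.I)) * h t) * g x = 0 := by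
  have him : ∀ t : ℝ, ((t : ℂ) - δ * Complex.I).im = -δ := fun t => by simp
  have him' : ∀ t : ℝ, ((t : ℂ) - δ * Complex.I).im ≠ 0 := fun t => by
    rw [him]; exact neg_ne_zero.mpr hδ.ne'
  have hker : ∀ x t : ℝ, 1 / ((t : ℂ) - (x + δ * Complex.I)) =
      -(1 / ((x : ℂ) - (t - δ * Complex.I))) := by
    intro x t
    rw [← div_neg]
    congr 1
    ring
  have hfun : ∀ x t : ℝ, 1 / ((t : ℂ) - (x + δ * Complex.I)) * h t * g x =
      -h t * (1 / ((x : ℂ) - (t - δ * Complex.I)) * g x) := by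
    intro x t
    rw [hker]
    ring
  have hmeas : AEStronglyMeasurable (fun p : ℝ × ℝ =>
      -h p.1 * (1 / ((p.2 : ℂ) - (p.1 - δ * Complex.I)) * g p.2)) (volume.prod volume) := by
    have m1 : AEStronglyMeasurable (fun p : ℝ × ℝ => -h p.1) (volume.prod volume) :=
      hh.1.comp_fst.neg
    have m2 : Continuous fun p : ℝ × ℝ => 1 / ((p.2 : ℂ) - (p.1 - δ * Complex.I)) :=
      Continuous.div continuous_const (by fun_prop) fun p => ofReal_sub_ne_zero (him' p.1) p.2
    have m3 : AEStronglyMeasurable (fun p : ℝ × ℝ => g p.2) (volume.prod volume) :=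
      hg.1.comp_snd
    exact m1.mul (m2.aestronglyMeasurable.mul m3)
  have hint : Integrable (fun p : ℝ × ℝ =>
      -h p.1 * (1 / ((p.2 : ℂ) - (p.1 - δ * Complex.I)) * g p.2)) (volume.prod volume) := by
    rw [integrable_prod_iff hmeas]
    refine ⟨Eventually.of_forall fun t => (integrable_mul_of_memLp_two
      (memLp_cauchyKernel (him' t)) hg).const_mul (-h t), ?_⟩
    refine Integrable.mono' (hh.norm.const_mul (Real.pi / δ + ∫ x : ℝ, ‖g x‖ ^ 2))
      hmeas.norm.integral_prod_right' (Eventually.of_forall fun t => ?_)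
    rw [Real.norm_of_nonneg (integral_nonneg fun _ => norm_nonneg _)]
    simp_rw [norm_mul (-h t), norm_neg]
    rw [integral_const_mul, mul_comm]
    refine mul_le_mul_of_nonneg_right ?_ (norm_nonneg _)
    have := integral_norm_cauchyKernel_mul_le hg (him' t)
    rwa [him, abs_neg, abs_of_pos hδ] at this
  simp_rw [← integral_mul_const, hfun]
  rw [← integral_integral_swap hint]
  refine integral_eq_zero_of_ae (Eventually.of_forall fun t => ?_)
  simp only [Pi.zero_apply]
  rw [integral_const_mul, horth _ (by rw [him]; linarith), mul_zero]

theorem continuous_comp_horizontal {F : ℂ → ℂ} (hF : DifferentiableOn ℂ F {z | 0 < z.im}) {y : ℝ}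
    (hy : 0 < y) : Continuous fun x : ℝ => F (x + y * Complex.I) :=
  hF.continuousOn.comp_continuous (by fun_prop) fun x => by simpa using hy

theorem memLp_two_of_lintegral_sq_le {f : ℝ → ℂ} (hf : Continuous f) {C : ENNReal} (hCt : C ≠ ⊤)
    (hC : ∫⁻ x : ℝ, ‖f x‖ₑ ^ 2 ≤ C) : MemLp f 2 volume := by
  rw [memLp_two_iff_integrable_sq_norm hf.aestronglyMeasurable]
  refine ⟨(hf.norm.pow 2).aestronglyMeasurable, ?_⟩
  refine lt_of_le_of_lt (le_trans (le_of_eq ?_) hC) hCt.lt_top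
  refine lintegral_congr fun x => ?_
  rw [enorm_pow, enorm_norm]

/-- The divisor `z + iN` supplies the integrability and decay that Cauchy's formula requires and
that `F` alone may lack. -/
theorem integral_horizontal_div_mul_eq_zero {F : ℂ → ℂ}
    (hF : DifferentiableOn ℂ F {z | 0 < z.im}) {C : ENNReal} (hCt : C ≠ ⊤)
    (hC : ∀ y : ℝ, 0 < y → ∫⁻ x : ℝ, ‖F (x + y * Complex.I)‖ₑ ^ 2 ≤ C) {g : ℝ → ℂ}
    (hg : MemLp g 2 volume)
    (horth : ∀ μ : ℂ, μ.im < 0 → ∫ x : ℝ, 1 / ((x : ℂ) - μ) * g x = 0) {y N : ℝ} (hy : 0 < y)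
    (hN : 0 < N) :
    ∫ x : ℝ, F (x + y * Complex.I) / (x + y * Complex.I + N * Complex.I) * g x = 0 := by
  -- One half of the height makes `H` holomorphic across the real line and bounded; the other keeps
  -- the evaluation point off the contour.
  set δ := y / 2 with hδ
  have hδ0 : 0 < δ := half_pos hy
  let U : Set ℂ := {w | -δ < w.im}
  have hUo : IsOpen U := isOpen_lt continuous_const Complex.continuous_im
  have hU : {z : ℂ | 0 ≤ z.im} ⊆ U := fun w hw => (neg_neg_of_pos hδ0).trans_le hw
  let H : ℂ → ℂ := fun w => F (w + δ * Complex.I) / (w + δ * Complex.I + N * Complex.I)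
  have hden : ∀ w ∈ U, w + δ * Complex.I + N * Complex.I ≠ 0 := by
    intro w hw h
    have := congrArg Complex.im h
    have hw' : -δ < w.im := hw
    simp at this
    linarith
  have hH : DifferentiableOn ℂ H U := by
    refine DifferentiableOn.div (hF.comp (by fun_prop) fun w hw => ?_) (by fun_prop) hden
    have hw' : -δ < w.im := hw
    simp only [Set.mem_ofPred_eq, Complex.add_im, Complex.mul_im, Complex.ofReal_re, Complex.I_im,
      Complex.ofReal_im, Complex.I_re]
    linarith
  have hμ : (-(δ + N) * Complex.I : ℂ).im ≠ 0 := by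
    simp only [Complex.mul_im, Complex.neg_re, Complex.add_re, Complex.ofReal_re, Complex.I_im,
      Complex.I_re]
    linarith
  have hi : Integrable fun t : ℝ => H t := by
    refine (integrable_mul_of_memLp_two (memLp_two_of_lintegral_sq_le
      (continuous_comp_horizontal hF hδ0) hCt (hC δ hδ0)) (memLp_cauchyKernel hμ)).congr
      (Eventually.of_forall fun t => ?_)
    simp only [H]
    rw [mul_one_div]
    congr 1
    ring
  obtain ⟨M, hM⟩ := exists_norm_le_of_lintegral_sq_le hF hCt hC hδ0
  have hbound : ∀ w : ℂ, 0 ≤ w.im → ‖H w‖ * ‖w‖ ≤ M := by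
    intro w hw
    have h1 : ‖w‖ ≤ ‖w + δ * Complex.I + N * Complex.I‖ := by
      rw [← sq_le_sq₀ (norm_nonneg _) (norm_nonneg _), ← Complex.normSq_eq_norm_sq,
        ← Complex.normSq_eq_norm_sq, Complex.normSq_apply, Complex.normSq_apply]
      simp
      nlinarith [mul_nonneg hw hδ0.le, mul_nonneg hw hN.le, mul_pos hδ0 hN]
    have h2 : 0 < ‖w + δ * Complex.I + N * Complex.I‖ := norm_pos_iff.mpr (hden w (hU hw))
    have h3 : ‖F (w + δ * Complex.I)‖ ≤ M := hM _ (by simpa using hw)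
    simp only [H]
    rw [norm_div, div_mul_eq_mul_div, div_le_iff₀ h2]
    exact mul_le_mul h3 h1 (norm_nonneg _) ((norm_nonneg _).trans h3)
  have key := integral_cauchyIntegral_mul_eq_zero hi hg horth hδ0
  have hcauchy : ∀ x : ℝ, ∫ t : ℝ, 1 / ((t : ℂ) - (x + δ * Complex.I)) * H t =
      2 * Real.pi * Complex.I * H (x + δ * Complex.I) := fun x =>
    cauchy_formula_halfPlane hUo hU hH hi hbound (by simpa using hδ0)
  simp_rw [hcauchy, mul_assoc (2 * Real.pi * Complex.I : ℂ)] at key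
  rw [integral_const_mul] at key
  have h2 := (mul_eq_zero.mp key).resolve_left Complex.two_pi_I_ne_zero
  rw [← h2]
  refine integral_congr_ae (Eventually.of_forall fun x => ?_)
  have e : (x : ℂ) + δ * Complex.I + δ * Complex.I = x + y * Complex.I := by
    rw [hδ]
    push_cast
    ring
  simp only [H]
  rw [e]

/-- The divisor is removed by dominated convergence: the multipliers `iN/(z + iN)`, with `N = n + 1
> 0`, are bounded by 1 and tend to 1. -/
theorem integral_horizontal_mul_eq_zero {F : ℂ → ℂ}
    (hF : DifferentiableOn ℂ F {z | 0 < z.im}) {C : ENNReal} (hCt : C ≠ ⊤)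
    (hC : ∀ y : ℝ, 0 < y → ∫⁻ x : ℝ, ‖F (x + y * Complex.I)‖ₑ ^ 2 ≤ C) {g : ℝ → ℂ}
    (hg : MemLp g 2 volume)
    (horth : ∀ μ : ℂ, μ.im < 0 → ∫ x : ℝ, 1 / ((x : ℂ) - μ) * g x = 0) {y : ℝ} (hy : 0 < y) :
    ∫ x : ℝ, F (x + y * Complex.I) * g x = 0 := by
  have hint : Integrable fun x : ℝ => F (x + y * Complex.I) * g x :=
    integrable_mul_of_memLp_two (memLp_two_of_lintegral_sq_le
      (continuous_comp_horizontal hF hy) hCt (hC y hy)) hg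
  let m : ℕ → ℝ → ℂ := fun n x =>
    ((n + 1 : ℝ) : ℂ) * Complex.I / (x + y * Complex.I + (n + 1 : ℝ) * Complex.I)
  have hden : ∀ (n : ℕ) (x : ℝ), (n + 1 : ℝ) ≤
      ‖(x : ℂ) + y * Complex.I + (n + 1 : ℝ) * Complex.I‖ := by
    intro n x
    have := (le_abs_self _).trans
      (Complex.abs_im_le_norm ((x : ℂ) + y * Complex.I + (n + 1 : ℝ) * Complex.I))
    simp only [Complex.add_im, Complex.mul_im, Complex.ofReal_re, Complex.I_im, Complex.ofReal_im,
      Complex.I_re] at this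
    linarith
  have hden0 : ∀ (n : ℕ) (x : ℝ), (x : ℂ) + y * Complex.I + (n + 1 : ℝ) * Complex.I ≠ 0 := by
    intro n x
    rw [← norm_pos_iff]
    exact lt_of_lt_of_le (by positivity) (hden n x)
  have hm : ∀ n x, ‖m n x‖ ≤ 1 := by
    intro n x
    simp only [m]
    rw [norm_div, norm_mul, Complex.norm_I, mul_one, Complex.norm_real,
      Real.norm_of_nonneg (by positivity)]
    exact div_le_one_of_le₀ (hden n x) (norm_nonneg _)
  have hlim : ∀ x, Tendsto (fun n => m n x) atTop (𝓝 1) := by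
    intro x
    have hz : Tendsto (fun n : ℕ => ‖(x : ℂ) + y * Complex.I‖ / (n + 1 : ℝ)) atTop (𝓝 0) :=
      tendsto_const_nhds.div_atTop
        (tendsto_atTop_add_const_right _ _ tendsto_natCast_atTop_atTop)
    rw [tendsto_iff_norm_sub_tendsto_zero]
    refine squeeze_zero (fun _ => norm_nonneg _) (fun n => ?_) hz
    have e : m n x - 1 = -((x : ℂ) + y * Complex.I) /
        (x + y * Complex.I + (n + 1 : ℝ) * Complex.I) := by
      have := hden0 n x
      simp only [m]
      rw [div_sub_one this]
      congr 1
      ring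
    rw [e, norm_div, norm_neg]
    exact div_le_div_of_nonneg_left (norm_nonneg _) (by positivity) (hden n x)
  have hzero : ∀ n, ∫ x : ℝ, m n x * (F (x + y * Complex.I) * g x) = 0 := by
    intro n
    have := integral_horizontal_div_mul_eq_zero hF hCt hC hg horth hy
      (N := (n + 1 : ℝ)) (by positivity)
    rw [← mul_zero (((n + 1 : ℝ) : ℂ) * Complex.I), ← this, ← integral_const_mul]
    refine integral_congr_ae (Eventually.of_forall fun x => ?_)
    simp only [m]
    ring
  have hconv := tendsto_integral_of_dominated_convergence
    (F := fun n (x : ℝ) => m n x * (F (x + y * Complex.I) * g x))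
    (f := fun x : ℝ => F (x + y * Complex.I) * g x)
    (fun x : ℝ => ‖F (x + y * Complex.I) * g x‖)
    (fun n => ?_) hint.norm (fun n => Eventually.of_forall fun x => ?_)
    (Eventually.of_forall fun x => ?_)
  · simp_rw [hzero] at hconv
    exact (tendsto_nhds_unique hconv tendsto_const_nhds)
  · refine AEStronglyMeasurable.mul ?_ hint.1
    exact (Continuous.div continuous_const (by fun_prop) (hden0 n)).aestronglyMeasurable
  · rw [norm_mul]
    exact mul_le_of_le_one_left (norm_nonneg _) (hm n x)
  · simpa using (hlim x).mul_const (F (x + y * Complex.I) * g x)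

theorem lintegral_sq_le_of_eLpNorm_le {f : ℝ → ℂ} {C : NNReal}
    (h : eLpNorm f 2 volume ≤ C) : ∫⁻ x : ℝ, ‖f x‖ₑ ^ 2 ≤ (C : ENNReal) ^ 2 := by
  have h1 := eLpNorm_nnreal_pow_eq_lintegral (μ := volume) (f := f) (p := 2) two_ne_zero
  simp only [NNReal.coe_ofNat, ENNReal.rpow_ofNat, ENNReal.coe_ofNat] at h1
  rw [← h1]
  gcongr

theorem integral_horizontal_mul_star_eq_zero {s : ℤˣ} {F : ℂ → ℂ}
    (hF : DifferentiableOn ℂ F (halfPlane (-s))) {C : NNReal}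
    (hC : ∀ y : ℝ, 0 < y → eLpNorm
      (fun x : ℝ => F (x + (((-s : ℤˣ) : ℤ) : ℂ) * y * Complex.I)) 2 volume ≤ C) {v : L2}
    (hv : ∀ μ ∈ halfPlane s, conjCauchy v μ = 0) {y : ℝ} (hy : 0 < y) :
    ∫ x : ℝ, F (x + (((-s : ℤˣ) : ℤ) : ℂ) * y * Complex.I) * (starRingEnd ℂ) (v x) = 0 := by
  have hC2 := fun y hy => lintegral_sq_le_of_eLpNorm_le (hC y hy)
  have hCt : (C : ENNReal) ^ 2 ≠ ⊤ := by finiteness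
  have hg := memLp_star (Lp.memLp v)
  rcases Int.units_eq_one_or s with rfl | rfl
  -- Here `F` lives in the lower half-plane. The reflection `z ↦ -z` preserves holomorphy and
  -- reduces to the upper one, with `v(-x)` in place of `v(x)`.
  · have hF' : DifferentiableOn ℂ (fun z => F (-z)) {z | 0 < z.im} :=
      hF.comp (by fun_prop) fun z hz => by simpa [halfPlane] using hz
    have hg' : MemLp (fun x : ℝ => (starRingEnd ℂ) (v (-x))) 2 volume :=
      hg.comp_measurePreserving (Measure.measurePreserving_neg volume)
    have hpt : ∀ x y : ℝ, F (-((x : ℂ) + y * Complex.I)) =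
        F (((-x : ℝ) : ℂ) + (((-1 : ℤˣ) : ℤ) : ℂ) * y * Complex.I) := by
      intro x y
      congr 1
      push_cast
      simp
      ring
    have hCneg : ∀ y : ℝ, 0 < y →
        ∫⁻ x : ℝ, ‖F (-((x : ℂ) + y * Complex.I))‖ₑ ^ 2 ≤ (C : ENNReal) ^ 2 := by
      intro y hy
      simp_rw [hpt]
      refine le_trans (le_of_eq ?_) (hC2 y hy)
      exact lintegral_neg_eq_self
        (fun x : ℝ => ‖F (x + (((-1 : ℤˣ) : ℤ) : ℂ) * y * Complex.I)‖ₑ ^ 2)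
    have := integral_horizontal_mul_eq_zero hF' hCt hCneg hg' (fun μ hμ => ?_) hy
    · simp_rw [hpt] at this
      rw [integral_neg_eq_self (fun x : ℝ =>
        F ((x : ℂ) + (((-1 : ℤˣ) : ℤ) : ℂ) * y * Complex.I) * (starRingEnd ℂ) (v x))
        volume] at this
      exact this
    · have h1 := hv (-μ) (by simpa [halfPlane] using hμ)
      rw [conjCauchy, ← integral_neg_eq_self, ← neg_eq_zero, ← integral_neg] at h1
      rw [← h1]
      refine integral_congr_ae (Eventually.of_forall fun x => ?_)
      simp only
      rw [← neg_mul, ← div_neg]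
      push_cast
      congr 2
      ring
  · have := integral_horizontal_mul_eq_zero (F := F)
      (hF.mono fun z hz => by simpa [halfPlane] using hz) hCt
      (fun y hy => by simpa using hC2 y hy) hg
      (fun μ hμ => hv μ (by simpa [halfPlane] using hμ)) hy
    simpa using this

/-- Since `S = Sᗮᗮ`, it suffices to test against `v ∈ Sᗮ`. The transform of `v̄` is holomorphic, so
kernels from a set of positive measure already force it to vanish on the half-plane. -/
theorem hardySpace_subset_of_ae_cauchyVec_mem {s : ℤˣ} {S : Submodule ℂ L2}
    (hS : IsClosed (S : Set L2)) {A : Set ℂ} (hA : A ⊆ halfPlane s) (hpos : 0 < volume A)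
    (hmem : ∀ μ (hμ : μ ∈ A), cauchyVec (halfPlane_im_ne_zero (hA hμ)) ∈ S) :
    hardySpace (-s) ⊆ (S : Set L2) := by
  rintro f ⟨F, hF, ⟨C, hC⟩, hlim⟩
  have hSc : Sᗮᗮ = S := by
    rw [Submodule.orthogonal_orthogonal_eq_closure]
    exact hS.submodule_topologicalClosure_eq
  rw [← hSc, SetLike.mem_coe, Submodule.mem_orthogonal]
  intro v hv
  have hv0 : ∀ μ ∈ halfPlane s, conjCauchy v μ = 0 := by
    refine eqOn_zero_of_measure_pos (isOpen_halfPlane s) (convex_halfPlane s).isPreconnected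
      (differentiableOn_conjCauchy v s) hA hpos fun μ hμ => ?_
    rw [← inner_cauchyVec v (halfPlane_im_ne_zero (hA hμ))]
    exact Submodule.inner_left_of_mem_orthogonal (hmem μ hμ) hv
  have hcont : ∀ y : ℝ, 0 < y →
      Continuous fun x : ℝ => F (x + (((-s : ℤˣ) : ℤ) : ℂ) * y * Complex.I) := by
    intro y hy
    refine hF.continuousOn.comp_continuous (by fun_prop) fun x => ?_
    rcases Int.units_eq_one_or s with rfl | rfl <;> simpa [halfPlane] using hy
  have hmemLp : ∀ y : ℝ, 0 < y →
      MemLp (fun x : ℝ => F (x + (((-s : ℤˣ) : ℤ) : ℂ) * y * Complex.I)) 2 volume :=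
    fun y hy => ⟨(hcont y hy).aestronglyMeasurable, (hC y hy).trans_lt ENNReal.coe_lt_top⟩
  -- The value for `y ≤ 0` is a filler that the one-sided limit never sees.
  let G : ℝ → L2 := fun y =>
    if hy : 0 < y then (hmemLp y hy).toLp _ else f
  have hG : Tendsto G (𝓝[>] 0) (𝓝 f) := by
    rw [Lp.tendsto_Lp_iff_tendsto_eLpNorm']
    refine hlim.congr' ?_
    filter_upwards [self_mem_nhdsWithin] with y hy
    refine eLpNorm_congr_ae ?_
    have hy' : 0 < y := hy
    simp only [G, dif_pos hy']
    filter_upwards [(hmemLp y hy').coeFn_toLp] with x hx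
    rw [Pi.sub_apply, hx]
  refine tendsto_nhds_unique ((tendsto_const_nhds (x := v)).inner hG)
    (tendsto_const_nhds.congr' ?_)
  filter_upwards [self_mem_nhdsWithin] with y hy
  have hy' : 0 < y := hy
  simp only [G, dif_pos hy']
  rw [inner_toLp_eq]
  exact (integral_horizontal_mul_star_eq_zero hF hC hv0 hy').symm

end Friedrichs

end

theorem mainTheorem2 (φ ψ : Friedrichs.L2) (s : ℤˣ) :
    -- `ℂ_± ∖ Ω_±` has measure zero
    (volume (Friedrichs.halfPlane s \ Friedrichs.nonUniq φ ψ) = 0 →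
      Friedrichs.hardySpace (-s) ⊆ (Friedrichs.detectable φ ψ : Set Friedrichs.L2)) ∧
    -- `ℂ_± ∖ Ω_±` has positive measure
    (0 < volume (Friedrichs.halfPlane s \ Friedrichs.nonUniq φ ψ) →
      -- on the uniqueness set the value is read off from the detectable subspace
      (∀ μ ∈ Friedrichs.halfPlane s \ Friedrichs.nonUniq φ ψ, Friedrichs.perturbD φ ψ μ ≠ 0 →
        ∀ η : ℂ,
          Friedrichs.FunMem (fun x : ℝ => 1 / ((x : ℂ) - μ) - η * (ψ x / ((x : ℂ) - μ)))
              (Friedrichs.detectable φ ψ) ↔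
            η = Friedrichs.conjCauchy φ μ / Friedrichs.perturbD φ ψ μ) ∧
      -- on the whole half-plane it is determined by `ψ` and the detectable subspace
      (∀ φ' : Friedrichs.L2, Friedrichs.detectable φ' ψ = Friedrichs.detectable φ ψ →
        ∀ μ ∈ Friedrichs.halfPlane s,
          Friedrichs.perturbD φ ψ μ ≠ 0 → Friedrichs.perturbD φ' ψ μ ≠ 0 →
            Friedrichs.conjCauchy φ' μ / Friedrichs.perturbD φ' ψ μ =
              Friedrichs.conjCauchy φ μ / Friedrichs.perturbD φ ψ μ)) := by
  refine ⟨fun h0 => ?_, fun hpos => ⟨fun μ hμ hD η => ?_, fun φ' hS μ hμ hD hD' =>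
    Friedrichs.ratio_eq_of_detectable_eq φ φ' ψ s hpos hS hμ hD hD'⟩⟩
  · refine Friedrichs.hardySpace_subset_of_ae_cauchyVec_mem
      (A := Friedrichs.halfPlane s ∩ Friedrichs.nonUniq φ ψ)
      (Submodule.isClosed_topologicalClosure _) Set.inter_subset_left ?_ fun μ hμ =>
        (Friedrichs.funMem_cauchyKernel_iff _ _).mp hμ.2.2.1
    -- Full measure of `Ω_±` enters only through its measure being positive.
    refine (Friedrichs.volume_halfPlane_pos s).trans_le ?_
    refine (measure_le_inter_add_sdiff _ _ (Friedrichs.nonUniq φ ψ)).trans ?_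
    rw [h0, add_zero]
  · have hμ' := Friedrichs.halfPlane_im_ne_zero hμ.1
    rw [Friedrichs.funMem_sub_iff ψ hμ']
    exact Friedrichs.eq_ratio_iff_sub_mem_detectable φ ψ hμ' hD hμ.2 η
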